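/- Languages are sets $L\subseteq\{0,1\}^*$, with $L(x)\in\{0,1\}$ the characteristic function. A language $L$ is in $\mathsf{YP}$ if there exist a deterministic algorithm $A$ with outputs in $\{0,1,\text{``don't know''}\}$ whose running time on $(x,y)$ is at most a polynomial in $|x|$, and a polynomial $p$, such that for all $n$: * there exists a string $y_n\in\{0,1\}^{p(n)}$ such that $A(x,y_n)$ outputs $L(x)$ for all $x\in\{0,1\}^n$; * $A(x,y)$ outputs either $L(x)$ or ``don't know'' for all $x\in\{0,1\}^n$ and all strings $y$. The class $\mathsf{YE}$ is defined in the same way, with both the advice size $p(n)$ and the running time of $A$ bounded by $2^{O(n)}$, where $n=|x|$. Let $\mathsf{E}$ and $\mathsf{NE}$ be deterministic and nondeterministic time $2^{O(n)}$, let $\mathsf{coNE}$ be the class of complements of languages in $\mathsf{NE}$, and let $\mathsf{ZPP}$ be the class of languages $L$ with a randomized polynomial-time algorithm that on every input $x$ always outputs $L(x)$ or ``don't know'', the latter with probability at most $1/2$. For a class $\mathcal C$ of languages, $\mathsf{NP}^{\mathcal C}$ and $\mathsf{NE}^{\mathcal C}$ are the classes of languages accepted by nondeterministic oracle machines with an oracle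 $O\in\mathcal C$ in polynomial time and in time $2^{O(n)}$ respectively (an $\mathsf{NE}$ machine may make queries of length $2^{O(n)}$). Then: 1. $\mathsf{ZPP}\subseteq\mathsf{YP}$. 2. $\mathsf{YE}=\mathsf{NE}\cap\mathsf{coNE}$. 3. If $\mathsf{P}=\mathsf{YP}$ then $\mathsf{E}=\mathsf{NE}\cap\mathsf{coNE}$. 4. If $\mathsf{E}=\mathsf{NE}^{\mathsf{NP}^{\mathsf{NP}}}$ then $\mathsf{P}=\mathsf{YP}$. -/

import Mathlib

/-!
Machine model: programs over a fixed finite number of bit stacks with a finite structured control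
and an oracle. A stack is one side of a Turing machine tape, every elementary instruction is one
move of a multi-tape oracle Turing machine with a finite control, and a multi-tape oracle Turing
machine is simulated by such a program with a constant-factor slowdown. Hence the time classes
below, whose bounds are closed under constant factors, are the usual ones.
-/

namespace UntrustedAdvice

/-- Programs. A program mentions finitely many registers, each of which is a stack of bits. -/
inductive Prog : Type
  /-- do nothing -/
  | skip : Prog
  /-- push the bit `b` onto register `r` -/
  | push (r : ℕ) (b : Bool) : Prog
  /-- remove the top bit of register `r` (no effect if it is empty) -/
  | pop (r : ℕ) : Prog
  /-- ask the oracle about the word in register `q`, push the answer bit onto register `a` -/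
  | query (q a : ℕ) : Prog
  /-- first `p`, then `q` -/
  | seq (p q : Prog) : Prog
  /-- continue with `pe`, `pf` or `pt` if register `r` is empty, has top bit `false`, or has
  top bit `true`, respectively -/
  | branch (r : ℕ) (pe pf pt : Prog) : Prog
  /-- while register `r` is not empty, do `p` -/
  | loop (r : ℕ) (p : Prog) : Prog

/-- The contents of all registers; the head of a list is the top of the stack. -/
abbrev Store : Type := ℕ → List Bool

/-- `Run O P s s' k`: with oracle `O`, program `P` started on the store `s` halts with the store
`s'` after exactly `k` steps. Each elementary instruction and each test costs one step. -/
inductive Run (O : Set (List Bool)) : Prog → Store → Store → ℕ → Prop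
  | skip (s : Store) : Run O Prog.skip s s 1
  | push (r : ℕ) (b : Bool) (s : Store) :
      Run O (Prog.push r b) s (Function.update s r (b :: s r)) 1
  | pop (r : ℕ) (s : Store) :
      Run O (Prog.pop r) s (Function.update s r (s r).tail) 1
  | query (q a : ℕ) (s : Store) (b : Bool) (hb : b = true ↔ s q ∈ O) :
      Run O (Prog.query q a) s (Function.update s a (b :: s a)) 1
  | seq {p q : Prog} {s s' s'' : Store} {k l : ℕ} (hp : Run O p s s' k) (hq : Run O q s' s'' l) :
      Run O (Prog.seq p q) s s'' (k + l)
  | branch_empty {r : ℕ} {pe pf pt : Prog} {s s' : Store} {k : ℕ} (hr : (s r).head? = none)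
      (h : Run O pe s s' k) : Run O (Prog.branch r pe pf pt) s s' (k + 1)
  | branch_false {r : ℕ} {pe pf pt : Prog} {s s' : Store} {k : ℕ}
      (hr : (s r).head? = some false) (h : Run O pf s s' k) :
      Run O (Prog.branch r pe pf pt) s s' (k + 1)
  | branch_true {r : ℕ} {pe pf pt : Prog} {s s' : Store} {k : ℕ}
      (hr : (s r).head? = some true) (h : Run O pt s s' k) :
      Run O (Prog.branch r pe pf pt) s s' (k + 1)
  | loop_done {r : ℕ} {p : Prog} {s : Store} (hr : s r = []) : Run O (Prog.loop r p) s s 1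
  | loop_step {r : ℕ} {p : Prog} {s s' s'' : Store} {k l : ℕ} (hr : s r ≠ [])
      (hp : Run O p s s' k) (hl : Run O (Prog.loop r p) s' s'' l) :
      Run O (Prog.loop r p) s s'' (k + l + 1)

/-- The initial store: the input `x` in register `0`, the auxiliary input `w` (a witness, a random
string, or advice) in register `1`, all other registers empty. -/
def initStore (x w : List Bool) : Store := fun r => if r = 0 then x else if r = 1 then w else []

/-- With oracle `O`, program `P` on input `x` and auxiliary input `w` halts after at most `t` steps
with output `out`, which is the top of register `0`. The outputs `some true` and `some false` are
the answers 1 and 0; the output `none` (register `0` is empty) is the answer "don't know". -/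
def OutputsIn (O : Set (List Bool)) (P : Prog) (x w : List Bool) (t : ℕ) (out : Option Bool) :
    Prop :=
  ∃ (s : Store) (k : ℕ), k ≤ t ∧ Run O P (initStore x w) s k ∧ (s 0).head? = out

open Classical in
/-- The characteristic function of a language, `L(x)`. -/
noncomputable def answer (L : Set (List Bool)) (x : List Bool) : Bool := decide (x ∈ L)

/-- The polynomials `ℕ → ℕ`. -/
def polyBounds : Set (ℕ → ℕ) := {f | ∃ p : Polynomial ℕ, ∀ n, f n = p.eval n}

/-- The functions `n ↦ 2 ^ (c * n + d)`; a function is `2 ^ O(n)` if and only if it is at most one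
of these. -/
def expBounds : Set (ℕ → ℕ) := {f | ∃ c d : ℕ, ∀ n, f n = 2 ^ (c * n + d)}

/-- Languages decided deterministically, without oracle, in a time bound from `T`. -/
def DTime (T : Set (ℕ → ℕ)) : Set (Set (List Bool)) :=
  {L | ∃ P : Prog, ∃ t ∈ T, ∀ x : List Bool,
    OutputsIn ∅ P x [] (t x.length) (some (answer L x))}

/-- Languages decided nondeterministically with oracle `O` in a time bound from `T`: the guessed
string `w` has length `p |x|`, and on every guess the machine halts within `t |x|` steps. -/
def NTimeOracle (T : Set (ℕ → ℕ)) (O : Set (List Bool)) : Set (Set (List Bool)) :=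
  {L | ∃ V : Prog, ∃ p ∈ T, ∃ t ∈ T,
    (∀ x w : List Bool, w.length = p x.length → ∃ out, OutputsIn O V x w (t x.length) out) ∧
    ∀ x : List Bool, x ∈ L ↔
      ∃ w : List Bool, w.length = p x.length ∧ OutputsIn O V x w (t x.length) (some true)}

/-- Nondeterministic time with an oracle from the class `C`. -/
def NTimeRel (T : Set (ℕ → ℕ)) (C : Set (Set (List Bool))) : Set (Set (List Bool)) :=
  {L | ∃ O ∈ C, L ∈ NTimeOracle T O}

/-- Languages decided with untrusted advice that depends only on the input length, where the advice
size and the running time (as functions of the input length) have bounds from `T`: some advice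
string makes `A` answer correctly on all inputs of length `n`, and on every advice string `A`
answers correctly or says "don't know". -/
def YTime (T : Set (ℕ → ℕ)) : Set (Set (List Bool)) :=
  {L | ∃ A : Prog, ∃ p ∈ T, ∃ t ∈ T, ∀ n : ℕ,
    (∃ y : List Bool, y.length = p n ∧
      ∀ x : List Bool, x.length = n → OutputsIn ∅ A x y (t n) (some (answer L x))) ∧
    ∀ x y : List Bool, x.length = n →
      OutputsIn ∅ A x y (t n) (some (answer L x)) ∨ OutputsIn ∅ A x y (t n) none}

/-- The complements of the languages in `C`. -/
def coClass (C : Set (Set (List Bool))) : Set (Set (List Bool)) := {L | Lᶜ ∈ C}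

/-- P -/
def classP : Set (Set (List Bool)) := DTime polyBounds

/-- E, deterministic time `2 ^ O(n)` -/
def classE : Set (Set (List Bool)) := DTime expBounds

/-- NP -/
def classNP : Set (Set (List Bool)) := NTimeOracle polyBounds ∅

/-- NE, nondeterministic time `2 ^ O(n)` -/
def classNE : Set (Set (List Bool)) := NTimeOracle expBounds ∅

/-- NP with an NP oracle -/
def classNPNP : Set (Set (List Bool)) := NTimeRel polyBounds classNP

/-- NE with an oracle from NP with an NP oracle -/
def classNENPNP : Set (Set (List Bool)) := NTimeRel expBounds classNPNP

/-- YP -/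
def classYP : Set (Set (List Bool)) := YTime polyBounds

/-- YE -/
def classYE : Set (Set (List Bool)) := YTime expBounds

/-- ZPP: polynomial-time machines with a uniformly random string of length `p |x|` that never give
a wrong answer, and on every input say "don't know" with probability at most one half. -/
def classZPP : Set (Set (List Bool)) :=
  {L | ∃ A : Prog, ∃ p ∈ polyBounds, ∃ t ∈ polyBounds, ∀ x : List Bool,
    (∀ r : List Bool, r.length = p x.length →
      OutputsIn ∅ A x r (t x.length) (some (answer L x)) ∨ OutputsIn ∅ A x r (t x.length) none) ∧
    2 * {r : List Bool | r.length = p x.length ∧ OutputsIn ∅ A x r (t x.length) none}.ncard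
      ≤ 2 ^ p x.length}

end UntrustedAdvice

namespace UntrustedAdvice

/-! ### Determinism of programs and renaming of registers. -/

section

variable {O : Set (List Bool)} {P Q : Prog} {s s' s'' : Store} {k l : ℕ}

/-! Untrusted advice plays two roles. Since a definite answer is never wrong, an advice string that
produces one is a certificate. Since one string serves all inputs of a length, it can also be
searched for once the length is known.

`ZPP ⊆ YP` is an averaging argument. Among the inputs of length `n` that are not yet served, some
random string makes the machine answer on at least half. After `n + 1` rounds fewer than one of the
`2 ^ n` inputs is left, and the list of chosen strings is the advice (`exists_cover`,
`outputsIn_repeatProg`). A bad list only produces "don't know".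

For `YE = NE ∩ coNE`, a nondeterministic machine guesses the advice, and complements are handled by
negating the answer. Conversely, exponentially long advice has room for a table with a witness of
membership or of non-membership for every input. The machine checks the entry with the two verifiers
before it answers, so a false table does no harm (`outputsIn_lookupProg`, `subset_classYE`).

The third claim is padding. If `L` is in `YE`, then its padded version, in which the relevant part
has logarithmic length, is in `YP` (`padLang_mem_classYP`). If that language is in `P`, writing out
the padding puts `L` in `E` (`mem_classE_of_padLang`). The other inclusion holds because an
algorithm may ignore its advice.

For the fourth claim, call advice reliable for `n` if the machine never says "don't know" on length
`n`. Unreliability is in `NP`: guess a bad input. Hence it is in `NP` with an `NP` oracle whether a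
given suffix extends to a reliable string, and asking this bit by bit, from the end, determines one
reliable string (`reliable_searchWord`). Given `n` and `k` in binary, the `k`-th bit is found in
time exponential in the length of this description (`searchLang_mem_nTimeOracle`), so by hypothesis
in `E`. The description has `O(log (n + k))` digits and `k` is polynomially bounded in `n`, so each
bit costs polynomial time; the whole advice is assembled and used (`outputsIn_assembleProg`).

The remaining work is programming with explicit step bounds: subroutines by renaming registers
(`exec_call`), loops along a sequence of stores (`exec_loop_seq`), and lengths computed in unary
(`UComputes`). -/

/-- The oracle answer is fixed by the oracle and the three branch tests exclude each other.
Determinism is what allows a known output of a run to be compared with a claimed one. -/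
theorem Run.det {s₁ s₂ : Store} {k₁ k₂ : ℕ} (h₁ : Run O P s s₁ k₁) (h₂ : Run O P s s₂ k₂) :
    s₁ = s₂ ∧ k₁ = k₂ := by
  induction h₁ generalizing s₂ k₂ with
  | skip s => cases h₂; exact ⟨rfl, rfl⟩
  | push r b s => cases h₂; exact ⟨rfl, rfl⟩
  | pop r s => cases h₂; exact ⟨rfl, rfl⟩
  | query q a s b hb =>
    cases h₂ with
    | query _ _ _ b' hb' =>
      have : b = b' := by rw [Bool.eq_iff_iff, hb, hb']
      subst this; exact ⟨rfl, rfl⟩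
  | seq hp hq ihp ihq =>
    cases h₂ with
    | seq hp' hq' =>
      obtain ⟨rfl, rfl⟩ := ihp hp'
      obtain ⟨rfl, rfl⟩ := ihq hq'
      exact ⟨rfl, rfl⟩
  | branch_empty hr h ih =>
    cases h₂ with
    | branch_empty hr' h' => obtain ⟨rfl, rfl⟩ := ih h'; exact ⟨rfl, rfl⟩
    | branch_false hr' h' => simp_all
    | branch_true hr' h' => simp_all
  | branch_false hr h ih =>
    cases h₂ with
    | branch_empty hr' h' => simp_all
    | branch_false hr' h' => obtain ⟨rfl, rfl⟩ := ih h'; exact ⟨rfl, rfl⟩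
    | branch_true hr' h' => simp_all
  | branch_true hr h ih =>
    cases h₂ with
    | branch_empty hr' h' => simp_all
    | branch_false hr' h' => simp_all
    | branch_true hr' h' => obtain ⟨rfl, rfl⟩ := ih h'; exact ⟨rfl, rfl⟩
  | loop_done hr =>
    cases h₂ with
    | loop_done _ => exact ⟨rfl, rfl⟩
    | loop_step hr' _ _ => exact absurd hr hr'
  | loop_step hr hp hl ihp ihl =>
    cases h₂ with
    | loop_done hr' => exact absurd hr' hr
    | loop_step hr' hp' hl' =>
      obtain ⟨rfl, rfl⟩ := ihp hp'
      obtain ⟨rfl, rfl⟩ := ihl hl'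
      exact ⟨rfl, rfl⟩

theorem OutputsIn.det {x w : List Bool} {t t' : ℕ} {o o' : Option Bool}
    (h : OutputsIn O P x w t o) (h' : OutputsIn O P x w t' o') : o = o' := by
  obtain ⟨s, k, -, hr, rfl⟩ := h
  obtain ⟨s', k', -, hr', rfl⟩ := h'
  rw [(hr.det hr').1]

theorem OutputsIn.mono {x w : List Bool} {t t' : ℕ} {o : Option Bool}
    (h : OutputsIn O P x w t o) (ht : t ≤ t') : OutputsIn O P x w t' o := by
  obtain ⟨s, k, hk, hr, ho⟩ := h
  exact ⟨s, k, hk.trans ht, hr, ho⟩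

/-- Renaming of the registers of a program. -/
def Prog.map (σ : ℕ → ℕ) : Prog → Prog
  | .skip => .skip
  | .push r b => .push (σ r) b
  | .pop r => .pop (σ r)
  | .query q a => .query (σ q) (σ a)
  | .seq p q => .seq (p.map σ) (q.map σ)
  | .branch r pe pf pt => .branch (σ r) (pe.map σ) (pf.map σ) (pt.map σ)
  | .loop r p => .loop (σ r) (p.map σ)

/-- The basis of subroutine calls: a renamed program acts on its own registers as before and leaves
everything outside the range of `σ` alone. -/
theorem Run.map {σ : ℕ → ℕ} (hσ : σ.Injective) (h : Run O P s s' k) (t : Store)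
    (ht : ∀ r, t (σ r) = s r) :
    ∃ t' : Store, (∀ r, t' (σ r) = s' r) ∧ (∀ q, q ∉ Set.range σ → t' q = t q) ∧
      Run O (P.map σ) t t' k := by
  have upd : ∀ (t s : Store), (∀ r, t (σ r) = s r) → ∀ r v,
      (∀ q, Function.update t (σ r) v (σ q) = Function.update s r v q) ∧
      ∀ q, q ∉ Set.range σ → Function.update t (σ r) v q = t q := by
    intro t s hts r v
    refine ⟨fun q => ?_, fun q hq => ?_⟩
    · by_cases hqr : q = r
      · subst hqr; simp
      · rw [Function.update_of_ne hqr, Function.update_of_ne (fun h => hqr (hσ h)), hts]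
    · exact Function.update_of_ne (fun h => hq ⟨r, h.symm⟩) _ _
  induction h generalizing t with
  | skip s => exact ⟨t, ht, fun _ _ => rfl, .skip t⟩
  | push r b s =>
    obtain ⟨h1, h2⟩ := upd t s ht r (b :: s r)
    exact ⟨_, h1, h2, by rw [← ht r]; exact .push (σ r) b t⟩
  | pop r s =>
    obtain ⟨h1, h2⟩ := upd t s ht r (s r).tail
    exact ⟨_, h1, h2, by rw [← ht r]; exact .pop (σ r) t⟩
  | query q a s b hb =>
    obtain ⟨h1, h2⟩ := upd t s ht a (b :: s a)
    exact ⟨_, h1, h2, by rw [← ht a]; exact .query (σ q) (σ a) t b (by rw [ht]; exact hb)⟩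
  | seq hp hq ihp ihq =>
    obtain ⟨t₁, h1, h2, h3⟩ := ihp t ht
    obtain ⟨t₂, g1, g2, g3⟩ := ihq t₁ h1
    exact ⟨t₂, g1, fun q hq => (g2 q hq).trans (h2 q hq), .seq h3 g3⟩
  | branch_empty hr h ih =>
    obtain ⟨t₁, h1, h2, h3⟩ := ih t ht
    exact ⟨t₁, h1, h2, .branch_empty (by rw [ht]; exact hr) h3⟩
  | branch_false hr h ih =>
    obtain ⟨t₁, h1, h2, h3⟩ := ih t ht
    exact ⟨t₁, h1, h2, .branch_false (by rw [ht]; exact hr) h3⟩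
  | branch_true hr h ih =>
    obtain ⟨t₁, h1, h2, h3⟩ := ih t ht
    exact ⟨t₁, h1, h2, .branch_true (by rw [ht]; exact hr) h3⟩
  | loop_done hr => exact ⟨t, ht, fun _ _ => rfl, .loop_done (by rw [ht]; exact hr)⟩
  | loop_step hr hp hl ihp ihl =>
    obtain ⟨t₁, h1, h2, h3⟩ := ihp t ht
    obtain ⟨t₂, g1, g2, g3⟩ := ihl t₁ h1
    exact ⟨t₂, g1, fun q hq => (g2 q hq).trans (h2 q hq),
      .loop_step (by rw [ht]; exact hr) h3 g3⟩

/-- A number larger than all registers that a program mentions. -/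
def Prog.width : Prog → ℕ
  | .skip => 0
  | .push r _ => r + 1
  | .pop r => r + 1
  | .query q a => q + a + 1
  | .seq p q => p.width + q.width
  | .branch r pe pf pt => r + 1 + pe.width + pf.width + pt.width
  | .loop r p => r + 1 + p.width

theorem Run.eq_of_width_le (h : Run O P s s' k) {r : ℕ} (hr : P.width ≤ r) : s' r = s r := by
  induction h with
  | skip s => rfl
  | push q b s | pop q s | query q a s b hb =>
    simp only [Prog.width] at hr
    exact Function.update_of_ne (by omega) _ _
  | seq hp hq ihp ihq =>
    simp only [Prog.width] at hr
    rw [ihq (by omega), ihp (by omega)]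
  | branch_empty _ _ ih | branch_false _ _ ih | branch_true _ _ ih =>
    simp only [Prog.width] at hr
    exact ih (by omega)
  | loop_done _ => rfl
  | loop_step _ _ _ ihp ihl =>
    rw [ihl hr]
    simp only [Prog.width] at hr
    exact ihp (by omega)

/-- A step lengthens a register by at most one bit. This bounds the cost of cleaning up after a
subroutine by its running time. -/
theorem Run.length_le (h : Run O P s s' k) (r : ℕ) : (s' r).length ≤ (s r).length + k := by
  induction h with
  | skip s => simp
  | push q b s =>
    by_cases hr : r = q
    · subst hr; simp
    · simp [Function.update_of_ne hr]
  | pop q s =>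
    by_cases hr : r = q
    · subst hr; simp; omega
    · simp [Function.update_of_ne hr]
  | query q a s b hb =>
    by_cases hr : r = a
    · subst hr; simp
    · simp [Function.update_of_ne hr]
  | seq _ _ ihp ihq => omega
  | branch_empty _ _ ih | branch_false _ _ ih | branch_true _ _ ih => omega
  | loop_done _ => omega
  | loop_step _ _ _ ihp ihl => omega

/-! ### Executions with step bounds, and stores given by lists of registers. -/

/-- The program `P` takes the store `s` to the store `s'` in at most `k` steps. -/
def Exec (O : Set (List Bool)) (P : Prog) (s s' : Store) (k : ℕ) : Prop :=
  ∃ j ≤ k, Run O P s s' j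

theorem Exec.mono (h : Exec O P s s' k) (hkl : k ≤ l) : Exec O P s s' l := by
  obtain ⟨j, hj, hr⟩ := h
  exact ⟨j, hj.trans hkl, hr⟩

theorem Exec.of_eq (h : Exec O P s s' k) (e : s' = s'') (hkl : k ≤ l) : Exec O P s s'' l :=
  e ▸ h.mono hkl

theorem Exec.seq (h : Exec O P s s' k) (h' : Exec O Q s' s'' l) :
    Exec O (.seq P Q) s s'' (k + l) := by
  obtain ⟨j, hj, hr⟩ := h
  obtain ⟨j', hj', hr'⟩ := h'
  exact ⟨j + j', by omega, .seq hr hr'⟩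

theorem exec_skip : Exec O .skip s s 1 := ⟨1, le_rfl, .skip s⟩

theorem exec_branch {r : ℕ} {pe pf pt : Prog}
    (he : s r = [] → Exec O pe s s' k) (hf : ∀ u, s r = false :: u → Exec O pf s s' k)
    (ht : ∀ u, s r = true :: u → Exec O pt s s' k) :
    Exec O (.branch r pe pf pt) s s' (k + 1) := by
  rcases hsr : s r with _ | ⟨_ | _, u⟩
  · obtain ⟨j, hj, hr⟩ := he hsr
    exact ⟨j + 1, by omega, .branch_empty (by simp [hsr]) hr⟩
  · obtain ⟨j, hj, hr⟩ := hf u hsr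
    exact ⟨j + 1, by omega, .branch_false (by simp [hsr]) hr⟩
  · obtain ⟨j, hj, hr⟩ := ht u hsr
    exact ⟨j + 1, by omega, .branch_true (by simp [hsr]) hr⟩

theorem exec_loop_done {r : ℕ} (hr : s r = []) : Exec O (.loop r P) s s 1 :=
  ⟨1, le_rfl, .loop_done hr⟩

theorem exec_loop_step {r : ℕ} (hr : s r ≠ []) (hp : Exec O P s s' k)
    (hl : Exec O (.loop r P) s' s'' l) : Exec O (.loop r P) s s'' (k + l + 1) := by
  obtain ⟨j, hj, h⟩ := hp
  obtain ⟨j', hj', h'⟩ := hl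
  exact ⟨j + j' + 1, by omega, .loop_step hr h h'⟩

/-- A loop whose body decreases the index of an invariant. -/
theorem exec_loop_inv {r : ℕ} (I : ℕ → Store → Prop) (h0 : ∀ s, I 0 s → s r = [])
    (hs : ∀ i s, I (i + 1) s → s r ≠ [] ∧ ∃ s', Exec O P s s' k ∧ I i s') (n : ℕ) {s : Store}
    (h : I n s) : ∃ s', Exec O (.loop r P) s s' (n * (k + 1) + 1) ∧ I 0 s' := by
  induction n generalizing s with
  | zero => exact ⟨s, by simpa using exec_loop_done (h0 s h), h⟩
  | succ n ih =>
    obtain ⟨hne, s₁, h1, h2⟩ := hs n s h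
    obtain ⟨s₂, h3, h4⟩ := ih h2
    exact ⟨s₂, (exec_loop_step hne h1 h3).mono (by ring_nf; omega), h4⟩

/-- A loop that runs through an explicit sequence of stores. -/
theorem exec_loop_seq {r n : ℕ} (f : ℕ → Store) (h0 : f 0 r = [])
    (hs : ∀ i < n, f (i + 1) r ≠ [] ∧ Exec O P (f (i + 1)) (f i) k) :
    Exec O (.loop r P) (f n) (f 0) (n * (k + 1) + 1) := by
  obtain ⟨s', h1, rfl, -⟩ := exec_loop_inv (O := O) (P := P) (r := r) (k := k)
    (fun i s => s = f i ∧ i ≤ n) (by rintro s ⟨rfl, -⟩; exact h0)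
    (by
      rintro i s ⟨rfl, hi⟩
      exact ⟨(hs i hi).1, _, (hs i hi).2, rfl, by omega⟩) n (s := f n) ⟨rfl, le_rfl⟩
  exact h1

/-- The store with the given contents of the first registers, all others empty. -/
def st (l : List (List Bool)) : Store := fun r => l.getD r []

theorem update_st {l : List (List Bool)} {r : ℕ} (hr : r < l.length) (v : List Bool) :
    Function.update (st l) r v = st (l.set r v) := by
  funext q
  by_cases hq : q = r
  · subst hq; simp [st, hr]
  · rw [Function.update_of_ne hq]
    simp [st, List.getD_eq_getElem?_getD, Ne.symm hq]

theorem st_append_replicate (l : List (List Bool)) (n : ℕ) :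
    st (l ++ List.replicate n []) = st l := by
  funext q
  simp only [st, List.getD_eq_getElem?_getD, List.getElem?_append]
  split_ifs with h
  · rfl
  · rw [List.getElem?_replicate, List.getElem?_eq_none (by omega : l.length ≤ q)]
    split_ifs <;> rfl

theorem initStore_eq (x w : List Bool) (n : ℕ) :
    initStore x w = st ([x, w] ++ List.replicate n []) := by
  rw [st_append_replicate]
  funext q
  rcases q with _ | _ | q <;> simp [initStore, st]

theorem Exec.outputsIn {x w : List Bool} {l : List (List Bool)} {n : ℕ} {o : Option Bool}
    (h : Exec O P (st ([x, w] ++ List.replicate n [])) (st l) k) (ho : (l.getD 0 []).head? = o) :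
    OutputsIn O P x w k o := by
  obtain ⟨j, hj, hr⟩ := h
  rw [← initStore_eq] at hr
  exact ⟨_, j, hj, hr, ho⟩

variable {L L' : List (List Bool)} {a b t r : ℕ}

/-- The resulting list is a free variable with an equation, so that a target in a different but
equal form can be given; for concrete lists the side conditions are discharged by the default
tactics. -/
theorem exec_push {v : Bool} (h : L.set r (v :: L.getD r []) = L' := by rfl)
    (hr : r < L.length := by simp) : Exec O (.push r v) (st L) (st L') 1 := by
  subst h
  rw [← update_st hr]
  exact ⟨1, le_rfl, .push r v (st L)⟩

theorem exec_pop (h : L.set r (L.getD r []).tail = L' := by rfl)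
    (hr : r < L.length := by simp) : Exec O (.pop r) (st L) (st L') 1 := by
  subst h
  rw [← update_st hr]
  exact ⟨1, le_rfl, .pop r (st L)⟩

open Classical in
theorem exec_query (h : L.set a (decide (L.getD r [] ∈ O) :: L.getD a []) = L' := by rfl)
    (ha : a < L.length := by simp) : Exec O (.query r a) (st L) (st L') 1 := by
  subst h
  rw [← update_st ha]
  exact ⟨1, le_rfl, .query r a (st L) _ (by simp [st])⟩

/-! ### Clearing, moving and copying registers. -/

/-- Empty a register. -/
def clear (r : ℕ) : Prog := .loop r (.pop r)

theorem exec_clear_store (r : ℕ) (s : Store) :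
    Exec O (clear r) s (Function.update s r []) (2 * (s r).length + 1) := by
  rcases h : s r with _ | ⟨b, u⟩
  · rw [← h, Function.update_eq_self]
    exact (exec_loop_done h).mono (by simp [h])
  · have := exec_clear_store r (Function.update s r u)
    simp only [Function.update_idem, Function.update_self] at this
    have hp : Exec O (.pop r) s (Function.update s r u) 1 :=
      ⟨1, le_rfl, by simpa [h] using Run.pop (O := O) r s⟩
    exact (exec_loop_step (by simp [h]) hp this).mono (by simp; omega)
termination_by (s r).length
decreasing_by simp [h]

theorem exec_clear (h : L.set r [] = L' := by rfl) (hr : r < L.length := by simp) :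
    Exec O (clear r) (st L) (st L') (2 * (L.getD r []).length + 1) := by
  subst h
  rw [← update_st hr]
  exact exec_clear_store r (st L)

/-- Move the contents of register `a` to register `b`, reversing the order. -/
def move (a b : ℕ) : Prog :=
  .loop a (.branch a .skip (.seq (.pop a) (.push b false)) (.seq (.pop a) (.push b true)))

theorem exec_move_store (hab : a ≠ b) (s : Store) :
    Exec O (move a b) s (Function.update (Function.update s a []) b ((s a).reverse ++ s b))
      (4 * (s a).length + 1) := by
  rcases h : s a with _ | ⟨v, u⟩
  · rw [← h, Function.update_eq_self]
    simp only [List.length_nil, h, List.reverse_nil, List.nil_append, Function.update_eq_self]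
    exact exec_loop_done h
  · have ih := exec_move_store hab (Function.update (Function.update s a u) b (v :: s b))
    have hb : ∀ v u, s a = v :: u → Exec O (.seq (.pop a) (.push b v)) s
        (Function.update (Function.update s a u) b (v :: s b)) 2 := by
      intro v u h
      have h1 := Run.pop (O := O) a s
      have h2 := Run.push (O := O) b v (Function.update s a (s a).tail)
      rw [Function.update_of_ne hab.symm, h] at h2
      rw [h] at h1
      exact ⟨2, le_rfl, h1.seq h2⟩
    have hbody := exec_branch (O := O) (r := a) (s := s) (k := 2)
      (s' := Function.update (Function.update s a u) b (v :: s b))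
      (pe := .skip) (pf := .seq (.pop a) (.push b false)) (pt := .seq (.pop a) (.push b true))
      (by simp [h]) (fun u' hu => by rw [h] at hu; cases hu; exact hb _ _ h)
      (fun u' hu => by rw [h] at hu; cases hu; exact hb _ _ h)
    rw [Function.update_of_ne hab, Function.update_self] at ih
    have e : Function.update (Function.update (Function.update (Function.update s a u) b (v :: s b))
        a []) b (u.reverse ++ (Function.update (Function.update s a u) b (v :: s b) b)) =
        Function.update (Function.update s a []) b ((v :: u).reverse ++ s b) := by
      rw [Function.update_comm hab.symm, Function.update_idem, Function.update_idem]
      simp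
    rw [e] at ih
    exact (exec_loop_step (by simp [h]) hbody ih).mono (by simp; omega)
termination_by (s a).length
decreasing_by simp [h, Function.update_of_ne hab]

theorem exec_move (h : (L.set a []).set b ((L.getD a []).reverse ++ L.getD b []) = L' := by rfl)
    (hab : a ≠ b := by simp) (ha : a < L.length := by simp) (hb : b < L.length := by simp) :
    Exec O (move a b) (st L) (st L') (4 * (L.getD a []).length + 1) := by
  subst h
  rw [← update_st (by simpa using hb), ← update_st ha]
  exact exec_move_store hab (st L)

/-- Move the contents of register `a` to both registers `b` and `c`, reversing the order. -/
def fork (a b c : ℕ) : Prog :=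
  .loop a (.branch a .skip (.seq (.pop a) (.seq (.push b false) (.push c false)))
    (.seq (.pop a) (.seq (.push b true) (.push c true))))

theorem exec_fork_store {c : ℕ} (hab : a ≠ b) (hac : a ≠ c) (hbc : b ≠ c) (s : Store) :
    Exec O (fork a b c) s (Function.update (Function.update (Function.update s a []) b
      ((s a).reverse ++ s b)) c ((s a).reverse ++ s c)) (5 * (s a).length + 1) := by
  rcases h : s a with _ | ⟨v, u⟩
  · rw [← h, Function.update_eq_self]
    simp only [List.length_nil, h, List.reverse_nil, List.nil_append, Function.update_eq_self]
    exact exec_loop_done h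
  · set s₁ := Function.update (Function.update (Function.update s a u) b (v :: s b)) c (v :: s c)
      with hs₁
    have ih := exec_fork_store hab hac hbc s₁
    have hb : ∀ v u, s a = v :: u →
        Exec O (.seq (.pop a) (.seq (.push b v) (.push c v))) s
        (Function.update (Function.update (Function.update s a u) b (v :: s b)) c (v :: s c)) 3 := by
      intro v u h
      have h1 := Run.pop (O := O) a s
      have h2 := Run.push (O := O) b v (Function.update s a (s a).tail)
      rw [Function.update_of_ne hab.symm, h] at h2
      have h3 := Run.push (O := O) c v (Function.update (Function.update s a u) b (v :: s b))
      rw [Function.update_of_ne hbc.symm, Function.update_of_ne hac.symm] at h3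
      rw [h] at h1
      exact ⟨3, le_rfl, h1.seq (h2.seq h3)⟩
    have hbody := exec_branch (O := O) (r := a) (s := s) (k := 3) (s' := s₁)
      (pe := .skip) (pf := .seq (.pop a) (.seq (.push b false) (.push c false)))
      (pt := .seq (.pop a) (.seq (.push b true) (.push c true)))
      (by simp [h]) (fun u' hu => by rw [h] at hu; cases hu; exact hb _ _ h)
      (fun u' hu => by rw [h] at hu; cases hu; exact hb _ _ h)
    have e1 : s₁ a = u := by
      rw [hs₁, Function.update_of_ne hac, Function.update_of_ne hab, Function.update_self]
    have e2 : s₁ b = v :: s b := by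
      rw [hs₁, Function.update_of_ne hbc, Function.update_self]
    have e3 : s₁ c = v :: s c := by rw [hs₁, Function.update_self]
    have e : Function.update (Function.update (Function.update s₁ a []) b
      (u.reverse ++ v :: s b)) c (u.reverse ++ v :: s c) =
        Function.update (Function.update (Function.update s a []) b
      ((v :: u).reverse ++ s b)) c ((v :: u).reverse ++ s c) := by
      funext q
      simp only [Function.update_apply, hs₁]
      split_ifs <;> simp
    rw [e1, e2, e3, e] at ih
    exact (exec_loop_step (by simp [h]) hbody ih).mono (by simp; omega)
termination_by (s a).length
decreasing_by simp [h, Function.update_of_ne hab, Function.update_of_ne hac]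

/-- Push a copy of register `a` onto register `b`, using the empty register `t`. -/
def copy (a b t : ℕ) : Prog := .seq (move a t) (fork t a b)

theorem exec_copy_store (hab : a ≠ b) (hat : a ≠ t) (hbt : b ≠ t) (s : Store) (ht : s t = []) :
    Exec O (copy a b t) s (Function.update s b (s a ++ s b)) (9 * (s a).length + 2) := by
  have h1 := exec_move_store (O := O) hat s
  have h2 := exec_fork_store (O := O) hat.symm hbt.symm hab
    (Function.update (Function.update s a []) t ((s a).reverse ++ s t))
  rw [Function.update_self, Function.update_of_ne hbt, Function.update_of_ne hab.symm,
    Function.update_of_ne hat, Function.update_self] at h2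
  have e : Function.update (Function.update (Function.update (Function.update
      (Function.update s a []) t ((s a).reverse ++ s t)) t []) a
      (((s a).reverse ++ s t).reverse ++ [])) b (((s a).reverse ++ s t).reverse ++ s b) =
      Function.update s b (s a ++ s b) := by
    funext q
    simp only [Function.update_apply, ht]
    split_ifs <;> simp_all
  rw [e] at h2
  exact (h1.seq h2).mono (by simp [ht]; omega)

theorem exec_copy (h : L.set b (L.getD a [] ++ L.getD b []) = L' := by rfl)
    (ht : L.getD t [] = [] := by rfl) (hb : b < L.length := by simp)
    (hab : a ≠ b := by simp) (hat : a ≠ t := by simp) (hbt : b ≠ t := by simp) :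
    Exec O (copy a b t) (st L) (st L') (9 * (L.getD a []).length + 2) := by
  subst h
  rw [← update_st hb]
  exact exec_copy_store hab hat hbt (st L) ht

/-- Empty the registers `c, …, c + m - 1`. -/
def clearRange (c : ℕ) : ℕ → Prog
  | 0 => .skip
  | m + 1 => .seq (clearRange c m) (clear (c + m))

theorem exec_clearRange (c m B : ℕ) (s : Store) (hB : ∀ r, (s (c + r)).length ≤ B) :
    Exec O (clearRange c m) s (fun r => if c ≤ r ∧ r < c + m then [] else s r)
      (1 + m * (2 * B + 1)) := by
  induction m with
  | zero =>
    have : (fun r => if c ≤ r ∧ r < c + 0 then [] else s r) = s := by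
      funext r; rw [if_neg (by omega)]
    rw [this]
    exact exec_skip.mono (by omega)
  | succ m ih =>
    have h := exec_clear_store (O := O) (c + m) (fun r => if c ≤ r ∧ r < c + m then [] else s r)
    have e : Function.update (fun r => if c ≤ r ∧ r < c + m then [] else s r) (c + m) [] =
        (fun r => if c ≤ r ∧ r < c + (m + 1) then [] else s r) := by
      funext r
      by_cases hr : r = c + m
      · subst hr; simp
      · rw [Function.update_of_ne hr]
        have : (c ≤ r ∧ r < c + m) ↔ (c ≤ r ∧ r < c + (m + 1)) := by omega
        simp only [this]
    rw [e] at h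
    refine (ih.seq h).mono ?_
    have := hB m
    simp only [lt_irrefl, and_false, if_false, add_mul]
    omega

/-! ### Subroutine calls and unary computation of lengths. -/

/-- Run `P` as a subroutine on copies of the registers `a` and `b`, in the registers from `c` on,
and push its answer, if it gives one, onto register `o`. -/
def call (P : Prog) (c a b o : ℕ) : Prog :=
  .seq (copy a c (c + 2)) <| .seq (copy b (c + 1) (c + 2)) <|
  .seq (P.map (· + c)) <| .seq (.branch c .skip (.push o false) (.push o true)) <|
  clearRange c (P.width + 2)

/-- A bound for the number of steps of `call`, when the inputs have total length `N` and the
subroutine takes at most `k` steps. -/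
def callCost (P : Prog) (N k : ℕ) : ℕ := 9 * N + k + 7 + (P.width + 2) * (2 * (N + k) + 1)

/-- All registers from `c` on are empty at the start, so after copying the two inputs the renamed
program sees exactly its initial store. Clearing its work area afterwards restores this situation,
and calls can be repeated. -/
theorem exec_call {c o : ℕ} {out : Option Bool}
    (h : OutputsIn O P (L.getD a []) (L.getD b []) k out)
    (hL : L.set o (out.toList ++ L.getD o []) = L' := by rfl)
    (hc : L.length ≤ c := by simp) (ha : a < L.length := by simp) (hb : b < L.length := by simp)
    (ho : o < L.length := by simp) :
    Exec O (call P c a b o) (st L) (st L')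
      (callCost P ((L.getD a []).length + (L.getD b []).length) k) := by
  subst hL
  obtain ⟨s', j, hj, hrun, hout⟩ := h
  have hnil : ∀ r, c ≤ r → st L r = [] := fun r hr => by
    simp [st, List.getD_eq_getElem?_getD, List.getElem?_eq_none (hc.trans hr)]
  have h1 := exec_copy_store (O := O) (a := a) (b := c) (t := c + 2) (by omega) (by omega)
    (by omega) (st L) (hnil _ (by omega))
  set s₁ := Function.update (st L) c (st L a ++ st L c) with hs₁
  have h2 := exec_copy_store (O := O) (a := b) (b := c + 1) (t := c + 2) (by omega) (by omega)
    (by omega) s₁ (by rw [hs₁, Function.update_of_ne (by omega), hnil _ (by omega)])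
  set s₂ := Function.update s₁ (c + 1) (s₁ b ++ s₁ (c + 1)) with hs₂
  have hs₁b : s₁ b = st L b := by rw [hs₁, Function.update_of_ne (by omega)]
  have hinit : ∀ r, s₂ (r + c) = initStore (st L a) (st L b) r := by
    intro r
    rw [hs₂, hs₁b, hs₁]
    have hc1 := hnil (c + 1) (by omega)
    have hc0 := hnil c le_rfl
    rcases r with _ | _ | r
    · rw [Function.update_of_ne (by omega), zero_add, Function.update_self, hc0]
      simp [initStore]
    · rw [zero_add, add_comm 1 c, Function.update_self, Function.update_of_ne (by omega),
        hc1]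
      simp [initStore]
    · rw [Function.update_of_ne (by omega), Function.update_of_ne (by omega), hnil _ (by omega)]
      simp [initStore]
  obtain ⟨s₃, h31, h32, h33⟩ := hrun.map (σ := (· + c)) (add_left_injective c) s₂ hinit
  have hout' : (s₃ c).head? = out := by have := h31 0; simp only [zero_add] at this; rw [this, hout]
  have hs₃ : ∀ q < c, s₃ q = st L q := by
    intro q hq
    rw [h32 q (by rintro ⟨r, hr⟩; simp only at hr; omega), hs₂, Function.update_of_ne (by omega), hs₁,
      Function.update_of_ne (by omega)]
  set s₄ := Function.update s₃ o (out.toList ++ s₃ o) with hs₄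
  have hpush : ∀ v u, s₃ c = v :: u → Exec O (.push o v) s₃ s₄ 1 := by
    intro v u hv
    have : out = some v := by rw [← hout', hv]; rfl
    rw [hs₄, this]
    exact ⟨1, le_rfl, .push o v s₃⟩
  have h4 : Exec O (.branch c .skip (.push o false) (.push o true)) s₃ s₄ (1 + 1) := by
    refine exec_branch (fun hv => ?_) (hpush false) (hpush true)
    have : out = none := by rw [← hout', hv]; rfl
    rw [hs₄, this]
    simpa using exec_skip
  have hlen : ∀ r, (s₄ (c + r)).length ≤ (st L a).length + (st L b).length + k := by
    intro r
    rw [hs₄, Function.update_of_ne (by omega), add_comm c r, h31 r]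
    refine (hrun.length_le r).trans ?_
    have : (initStore (st L a) (st L b) r).length ≤ (st L a).length + (st L b).length := by
      unfold initStore; split_ifs <;> simp
    simp only [st] at this hj ⊢
    omega
  have h5 := exec_clearRange (O := O) c (P.width + 2) _ s₄ hlen
  have e : (fun r => if c ≤ r ∧ r < c + (P.width + 2) then [] else s₄ r) =
      st (L.set o (out.toList ++ L.getD o [])) := by
    rw [← update_st ho]
    funext q
    by_cases hq : q < c
    · rw [if_neg (by omega), hs₄]
      by_cases hqo : q = o
      · subst hqo; rw [Function.update_self, Function.update_self, hs₃ q hq]; rfl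
      · rw [Function.update_of_ne hqo, Function.update_of_ne hqo, hs₃ q hq]
    · rw [Function.update_of_ne (by omega), hnil q (by omega)]
      split_ifs with h
      · rfl
      · obtain ⟨r, rfl⟩ : ∃ r, q = r + c := ⟨q - c, by omega⟩
        -- Registers beyond the cleared range are not mentioned by `P` and are not its input
        -- registers, so they are still empty. The two extra cleared registers cover the inputs in
        -- case `P` has width less than two.
        rw [hs₄, Function.update_of_ne (by omega), h31 r, hrun.eq_of_width_le (by omega)]
        simp [initStore, show r ≠ 0 by omega, show r ≠ 1 by omega]
  rw [e] at h5
  have h3 : Exec O (P.map (· + c)) s₂ s₃ j := ⟨j, le_rfl, h33⟩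
  refine (h1.seq (h2.seq (h3.seq (h4.seq h5)))).mono ?_
  rw [hs₁b]
  simp only [st, callCost]
  ring_nf
  omega

/-- `P` computes the function `f` on lengths: it pushes `f n` bits `true` onto register `1`, where
`n` is the length of register `0`, and takes at most `τ n` steps. -/
def UComputes (P : Prog) (f τ : ℕ → ℕ) : Prop :=
  ∀ (O : Set (List Bool)) (x u : List Bool),
    Exec O P (st [x, u]) (st [x, List.replicate (f x.length) true ++ u]) (τ x.length)

/-- Run `P` with `a` and `b` as registers `0` and `1`, and registers above `c` as the others. -/
def ucall (P : Prog) (c a b : ℕ) : Prog :=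
  P.map fun r => if r = 0 then a else if r = 1 then b else c + r

/-- No cleaning is needed here: `UComputes` already demands that all registers other than the first
two end up empty. -/
theorem exec_ucall {c : ℕ} {f τ : ℕ → ℕ} (h : UComputes P f τ)
    (hL : L.set b (List.replicate (f (L.getD a []).length) true ++ L.getD b []) = L' := by rfl)
    (hc : L.length ≤ c := by simp) (hab : a ≠ b := by simp) (ha : a < L.length := by simp)
    (hb : b < L.length := by simp) :
    Exec O (ucall P c a b) (st L) (st L') (τ (L.getD a []).length) := by
  subst hL
  obtain ⟨j, hj, hr⟩ := h O (L.getD a []) (L.getD b [])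
  have hinj : Function.Injective (fun r => if r = 0 then a else if r = 1 then b else c + r) := by
    intro q r
    dsimp only
    split_ifs <;> omega
  have hnil : ∀ r, c ≤ r → st L r = [] := fun r hr => by
    simp [st, List.getD_eq_getElem?_getD, List.getElem?_eq_none (hc.trans hr)]
  obtain ⟨t', h1, h2, h3⟩ := hr.map hinj (st L) (by
    rintro (_ | _ | r)
    · rfl
    · rfl
    · simp [hnil (c + (r + 1 + 1)) (by omega)]
      simp [st])
  have e : t' = st (L.set b (List.replicate (f (L.getD a []).length) true ++ L.getD b [])) := by
    rw [← update_st hb]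
    funext q
    by_cases hq : q ∈ Set.range (fun r => if r = 0 then a else if r = 1 then b else c + r)
    · obtain ⟨r, rfl⟩ := hq
      rw [h1]
      rcases r with _ | _ | r
      · simp only [if_true]
        rw [Function.update_of_ne hab]; rfl
      · simp [st]
      · simp only [Nat.add_eq_zero_iff, one_ne_zero, and_false, if_false, Nat.add_eq_right]
        rw [Function.update_of_ne (by omega), hnil _ (by omega)]
        simp [st]
    · rw [h2 q hq, Function.update_of_ne (fun hqb => hq ⟨1, by simp [hqb]⟩)]
  rw [← e]
  exact ⟨j, hj, h3⟩

theorem exec_branch_st {M : List (List Bool)} {pe pf pt : Prog}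
    (he : L.getD r [] = [] → Exec O pe (st L) (st M) k)
    (hf : ∀ u, L.getD r [] = false :: u → Exec O pf (st L) (st M) k)
    (ht : ∀ u, L.getD r [] = true :: u → Exec O pt (st L) (st M) k) :
    Exec O (.branch r pe pf pt) (st L) (st M) (k + 1) := exec_branch he hf ht

/-! ### Reading blocks of bits, doubling and halving. -/

/-- The first `n` bits of a word that is continued by bits `false`. -/
def ptake : ℕ → List Bool → List Bool
  | 0, _ => []
  | n + 1, u => u.headD false :: ptake n u.tail

@[simp] theorem length_ptake (n : ℕ) (u : List Bool) : (ptake n u).length = n := by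
  induction n generalizing u with
  | zero => rfl
  | succ n ih => simp [ptake, ih]

theorem ptake_append (u v : List Bool) : ptake u.length (u ++ v) = u := by
  induction u with
  | nil => rfl
  | cons b u ih => simp [ptake, ih]

/-- Move one bit from register `a` to register `b`, the bit `false` if `a` is empty. -/
def takeBit (a b : ℕ) : Prog :=
  .branch a (.push b false) (.seq (.pop a) (.push b false)) (.seq (.pop a) (.push b true))

theorem exec_takeBit_store (hab : a ≠ b) (s : Store) : Exec O (takeBit a b) s
    (Function.update (Function.update s a (s a).tail) b ((s a).headD false :: s b)) 3 := by
  have key : ∀ v u, s a = v :: u → Exec O (.seq (.pop a) (.push b v)) s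
      (Function.update (Function.update s a (s a).tail) b ((s a).headD false :: s b)) 2 := by
    intro v u hv
    have h := Run.push (O := O) b v (Function.update s a (s a).tail)
    rw [Function.update_of_ne hab.symm] at h
    refine ⟨2, le_rfl, ?_⟩
    have e : (s a).headD false = v := by rw [hv]; rfl
    rw [e]
    exact (Run.pop a s).seq h
  refine exec_branch (fun hv => ?_) (key false) (key true)
  refine ⟨1, by omega, ?_⟩
  have e : Function.update s a (s a).tail = s := by
    rw [hv, List.tail_nil, ← hv, Function.update_eq_self]
  rw [e, hv]
  exact .push b false s

/-- Move as many bits as register `r` has from register `a` to register `b`, in reverse order,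
where `a` is thought to be continued by bits `false`; this empties `r`. -/
def takeBits (r a b : ℕ) : Prog := .loop r (.seq (.pop r) (takeBit a b))

theorem exec_takeBits_store (hra : r ≠ a) (hrb : r ≠ b) (hab : a ≠ b) (s : Store) :
    Exec O (takeBits r a b) s (Function.update (Function.update (Function.update s r []) a
      ((s a).drop (s r).length)) b ((ptake (s r).length (s a)).reverse ++ s b))
      (5 * (s r).length + 1) := by
  rcases h : s r with _ | ⟨v, u⟩
  · rw [← h, Function.update_eq_self]
    simp only [List.length_nil, h, List.drop_zero, ptake, List.reverse_nil, List.nil_append,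
      Function.update_eq_self]
    exact exec_loop_done h
  · set s₁ := Function.update s r u with hs₁
    set s₂ := Function.update (Function.update s₁ a (s₁ a).tail) b ((s₁ a).headD false :: s₁ b)
      with hs₂
    have hp : Exec O (.pop r) s s₁ 1 := ⟨1, le_rfl, by simpa [h] using Run.pop (O := O) r s⟩
    have ih := exec_takeBits_store hra hrb hab s₂
    have e1 : s₂ r = u := by
      rw [hs₂, Function.update_of_ne hrb, Function.update_of_ne hra, hs₁, Function.update_self]
    have e2 : s₂ a = (s a).tail := by
      rw [hs₂, Function.update_of_ne hab, Function.update_self, hs₁, Function.update_of_ne hra.symm]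
    have e3 : s₂ b = (s a).headD false :: s b := by
      rw [hs₂, Function.update_self, hs₁, Function.update_of_ne hrb.symm,
        Function.update_of_ne hra.symm]
    have e : Function.update (Function.update (Function.update s₂ r []) a
        ((s a).tail.drop u.length)) b ((ptake u.length (s a).tail).reverse ++
          ((s a).headD false :: s b)) =
        Function.update (Function.update (Function.update s r []) a
        ((s a).drop (v :: u).length)) b ((ptake (v :: u).length (s a)).reverse ++ s b) := by
      funext q
      simp only [Function.update_apply, hs₂, hs₁]
      split_ifs <;> simp [ptake]
    rw [e1, e2, e3, e] at ih
    exact (exec_loop_step (by simp [h]) (hp.seq (exec_takeBit_store hab s₁)) ih).mono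
      (by simp; omega)
termination_by (s r).length
decreasing_by simp [h, Function.update_of_ne hra, Function.update_of_ne hrb]

theorem exec_takeBits
    (h : ((L.set r []).set a ((L.getD a []).drop (L.getD r []).length)).set b
      ((ptake (L.getD r []).length (L.getD a [])).reverse ++ L.getD b []) = L' := by rfl)
    (hra : r ≠ a := by simp) (hrb : r ≠ b := by simp) (hab : a ≠ b := by simp)
    (hr : r < L.length := by simp) (ha : a < L.length := by simp) (hb : b < L.length := by simp) :
    Exec O (takeBits r a b) (st L) (st L') (5 * (L.getD r []).length + 1) := by
  subst h
  rw [← update_st (by simpa using hb), ← update_st (by simpa using ha), ← update_st hr]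
  exact exec_takeBits_store hra hrb hab (st L)

/-- Replace the contents of register `r` by twice as many bits `true`, using the empty
register `t`. -/
def double (r t : ℕ) : Prog :=
  .seq (.loop r (.seq (.pop r) (.seq (.push t true) (.push t true)))) (move t r)

/-- The word `true ^ n`. -/
abbrev ones (n : ℕ) : List Bool := List.replicate n true

theorem ones_append_cons (n : ℕ) (u : List Bool) : ones n ++ true :: u = true :: (ones n ++ u) := by
  induction n with
  | zero => rfl
  | succ n ih => simp [List.replicate_succ, ih]

theorem exec_double_store (hrt : r ≠ t) (s : Store) (ht : s t = []) :
    Exec O (double r t) s (Function.update s r (ones (2 * (s r).length)))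
      (12 * (s r).length + 2) := by
  have h1 : ∀ n (s : Store), (s r).length = n →
      Exec O (.loop r (.seq (.pop r) (.seq (.push t true) (.push t true)))) s
      (Function.update (Function.update s r []) t (ones (2 * n) ++ s t)) (4 * n + 1) := by
    intro n
    induction n with
    | zero =>
      intro s hs
      have hs := List.length_eq_zero_iff.mp hs
      rw [← hs, Function.update_eq_self]
      simpa using exec_loop_done hs
    | succ n ih =>
      intro s hs
      have h1 := Run.pop (O := O) r s
      have h2 := Run.push (O := O) t true (Function.update s r (s r).tail)
      have h3 := Run.push (O := O) t true (Function.update (Function.update s r (s r).tail) t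
        (true :: Function.update s r (s r).tail t))
      have h4 := ih _ (show (Function.update (Function.update (Function.update s r (s r).tail) t
        (true :: Function.update s r (s r).tail t)) t (true :: Function.update (Function.update s r
        (s r).tail) t (true :: Function.update s r (s r).tail t) t) r).length = n by
          rw [Function.update_of_ne hrt, Function.update_of_ne hrt, Function.update_self]
          simp [hs])
      refine (exec_loop_step (by rintro h; simp [h] at hs)
        ⟨3, le_rfl, h1.seq (h2.seq h3)⟩ h4).of_eq ?_ (by omega)
      funext q
      simp only [Function.update_apply]
      split_ifs <;> simp_all [mul_add, List.replicate_succ, ones_append_cons]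
  have h2 := (h1 _ s rfl).seq (exec_move_store (O := O) hrt.symm _)
  simp only [Function.update_self, ht, List.append_nil, List.length_replicate] at h2
  refine h2.of_eq ?_ (by omega)
  funext q
  simp only [Function.update_apply]
  split_ifs <;> simp_all

theorem exec_double (h : L.set r (ones (2 * (L.getD r []).length)) = L' := by rfl)
    (ht : L.getD t [] = [] := by rfl) (hrt : r ≠ t := by simp) (hr : r < L.length := by simp) :
    Exec O (double r t) (st L) (st L') (12 * (L.getD r []).length + 2) := by
  subst h
  rw [← update_st hr]
  exact exec_double_store hrt (st L) ht

/-- Halve the length of register `r`, and push the remainder onto register `q`, using the empty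
register `t`. -/
def halve (r t q : ℕ) : Prog :=
  .seq (.push q false) <| .seq
  (.loop r (.seq (.pop r) (.branch r (.seq (.pop q) (.push q true))
    (.seq (.pop r) (.push t true)) (.seq (.pop r) (.push t true))))) (move t r)

theorem exec_halve_store {q : ℕ} (hrt : r ≠ t) (hrq : r ≠ q) (htq : t ≠ q) (s : Store)
    (ht : s t = []) :
    Exec O (halve r t q) s (Function.update (Function.update s r (ones ((s r).length / 2))) q
      (decide ((s r).length % 2 = 1) :: s q)) (5 * (s r).length + 8) := by
  set lp : Prog := .loop r (.seq (.pop r) (.branch r (.seq (.pop q) (.push q true))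
    (.seq (.pop r) (.push t true)) (.seq (.pop r) (.push t true)))) with hlp
  -- A full pass removes two bits, hence strong induction. The provisional remainder `false` on top
  -- of `q` is replaced only in a pass that finds a single bit.
  have h1 : ∀ n, ∀ s : Store, (s r).length = n → (s q).head? = some false →
      Exec O lp s (Function.update (Function.update (Function.update s r []) t
        (ones (n / 2) ++ s t)) q (decide (n % 2 = 1) :: (s q).tail)) (3 * n + 4) := by
    intro n
    induction n using Nat.strong_induction_on with
    | _ n ih =>
    intro s hs hq
    rcases hu : s q with _ | ⟨b, u⟩
    · simp [hu] at hq
    obtain rfl : b = false := by simpa [hu] using hq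
    have hpop : Exec O (.pop r) s (Function.update s r (s r).tail) 1 := ⟨1, le_rfl, .pop r s⟩
    rcases n with _ | _ | n
    · have hs := List.length_eq_zero_iff.mp hs
      refine (exec_loop_done hs).of_eq ?_ (by omega)
      funext i
      simp only [Function.update_apply]
      split_ifs <;> simp_all
    · obtain ⟨v, hv⟩ := List.length_eq_one_iff.mp hs
      have hb := Run.branch_empty (O := O) (r := r) (s := Function.update s r (s r).tail)
        (pf := .seq (.pop r) (.push t true)) (pt := .seq (.pop r) (.push t true)) (by simp [hv])
        ((Run.pop q _).seq (Run.push q true _))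
      refine (exec_loop_step (r := r) (by simp [hv]) (hpop.seq ⟨_, le_rfl, hb⟩)
        (exec_loop_done (by simp [hv, Function.update_of_ne hrq]))).of_eq ?_ (by omega)
      funext i
      simp only [Function.update_apply]
      split_ifs <;> simp_all
    · obtain ⟨v, w, u', hv⟩ : ∃ v w u', s r = v :: w :: u' := by
        rcases hsr : s r with _ | ⟨v, _ | ⟨w, u'⟩⟩ <;> simp_all
      set s₁ := Function.update (Function.update s r u') t (true :: s t) with hs₁
      have hpp : Exec O (.seq (.pop r) (.push t true)) (Function.update s r (s r).tail) s₁ 2 := by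
        refine Exec.of_eq ⟨_, le_rfl, (Run.pop r _).seq (Run.push t true _)⟩ ?_ le_rfl
        funext i
        simp only [Function.update_apply, hs₁]
        split_ifs <;> simp_all
      have hb := exec_branch (O := O) (r := r) (s := Function.update s r (s r).tail) (s' := s₁)
        (pe := .seq (.pop q) (.push q true)) (by simp [hv]) (fun _ _ => hpp) (fun _ _ => hpp)
      have e1 : s₁ r = u' := by simp [hs₁, Function.update_of_ne hrt]
      have e2 : s₁ q = s q := by
        rw [hs₁, Function.update_of_ne htq.symm, Function.update_of_ne hrq.symm]
      have e3 : s₁ t = true :: s t := by rw [hs₁, Function.update_self]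
      have hn : (s₁ r).length = n := by simp_all
      refine (exec_loop_step (r := r) (by simp [hv]) (hpop.seq hb)
        (ih n (by omega) s₁ hn (by rw [e2]; exact hq))).of_eq ?_ (by omega)
      rw [e2, e3, show (n + 1 + 1) / 2 = n / 2 + 1 by omega,
        show (n + 1 + 1) % 2 = n % 2 by omega]
      funext i
      simp only [Function.update_apply, hs₁]
      split_ifs <;> simp [ones, List.replicate_succ', *]
  have h0 : Exec O (.push q false) s (Function.update s q (false :: s q)) 1 :=
    ⟨1, le_rfl, .push q false s⟩
  have e0 : Function.update s q (false :: s q) r = s r := Function.update_of_ne hrq _ _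
  have h2 := h1 (s r).length (Function.update s q (false :: s q)) (by rw [e0]) (by simp)
  have h3 := exec_move_store (O := O) hrt.symm (Function.update (Function.update
    (Function.update (Function.update s q (false :: s q)) r []) t
    (ones ((s r).length / 2) ++ Function.update s q (false :: s q) t)) q
    (decide ((s r).length % 2 = 1) :: (Function.update s q (false :: s q) q).tail))
  refine (h0.seq (h2.seq h3)).of_eq ?_ ?_
  · funext i
    simp only [Function.update_apply]
    split_ifs <;> simp_all [ones]
  · rw [Function.update_of_ne htq, Function.update_self, Function.update_of_ne htq, ht]
    simp
    omega

theorem exec_halve {q : ℕ}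
    (h : (L.set r (ones ((L.getD r []).length / 2))).set q
      (decide ((L.getD r []).length % 2 = 1) :: L.getD q []) = L' := by rfl)
    (ht : L.getD t [] = [] := by rfl) (hrt : r ≠ t := by simp) (hrq : r ≠ q := by simp)
    (htq : t ≠ q := by simp) (hr : r < L.length := by simp) (hq : q < L.length := by simp) :
    Exec O (halve r t q) (st L) (st L') (5 * (L.getD r []).length + 8) := by
  subst h
  rw [← update_st (by simpa using hq), ← update_st hr]
  exact exec_halve_store hrt hrq htq (st L) ht

end

/-! ### Functions computable in unary and classes of time bounds. -/

variable {O : Set (List Bool)} {P Q : Prog} {T : Set (ℕ → ℕ)} {f g τ τ' : ℕ → ℕ}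

theorem ones_append_ones (m n : ℕ) (u : List Bool) : ones m ++ (ones n ++ u) = ones (m + n) ++ u := by
  rw [← List.append_assoc, List.replicate_append_replicate]

/-- Padding with empty registers. -/
theorem st_pad (L : List (List Bool)) (n : ℕ) {L' : List (List Bool)}
    (h : L ++ List.replicate n [] = L' := by rfl) : st L = st L' := by
  rw [← h, st_append_replicate]

theorem UComputes.const (c : ℕ) : ∃ P, UComputes P (fun _ => c) (fun _ => c + 1) := by
  induction c with
  | zero => exact ⟨.skip, fun O x u => exec_skip⟩
  | succ c ih =>
    obtain ⟨P, hP⟩ := ih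
    exact ⟨.seq P (.push 1 true), fun O x u => (hP O x u).seq (exec_push rfl)⟩

theorem UComputes.id :
    ∃ P, UComputes P (fun n => n) (fun n => 9 * n + 2 + (n * (1 + 1 + 1) + 1)) := by
  refine ⟨.seq (copy 0 2 3) (.loop 2 (.seq (.pop 2) (.push 1 true))), fun O x u => ?_⟩
  rw [st_pad [x, u] 2, st_pad [x, _] 2]
  refine (exec_copy (L' := [x, u, x, []]) (by simp)).seq ?_
  have h := exec_loop_seq (O := O) (P := .seq (.pop 2) (.push 1 true)) (r := 2) (k := 1 + 1)
    (n := x.length)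
    (fun i => st [x, ones (x.length - i) ++ u, x.drop (x.length - i), []]) (by simp [st])
    (fun i hi => by
      have e : x.length - i = x.length - (i + 1) + 1 := by omega
      refine ⟨by simp [st]; omega, (exec_pop rfl).seq (exec_push ?_)⟩
      simp [e, List.replicate_succ])
  simpa using h

theorem UComputes.add {P Q : Prog} (hP : UComputes P f τ) (hQ : UComputes Q g τ') :
    UComputes (.seq P Q) (fun n => f n + g n) (fun n => τ n + τ' n) := by
  intro O x u
  have h := (hP O x u).seq (hQ O x _)
  rwa [ones_append_ones, add_comm (g _)] at h

theorem UComputes.mul {P Q : Prog} (hP : UComputes P f τ) (hQ : UComputes Q g τ') :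
    UComputes (.seq (ucall P 3 0 2) (.loop 2 (.seq (.pop 2) (ucall Q 3 0 1))))
      (fun n => f n * g n) (fun n => τ n + (f n * (1 + τ' n + 1) + 1)) := by
  intro O x u
  rw [st_pad [x, u] 1, st_pad [x, _] 1]
  refine (exec_ucall hP).seq ?_
  have h := exec_loop_seq (O := O) (P := .seq (.pop 2) (ucall Q 3 0 1)) (r := 2)
    (k := 1 + τ' x.length) (n := f x.length)
    (fun i => st [x, ones ((f x.length - i) * g x.length) ++ u, ones i]) (by simp [st])
    (fun i hi => by
      have e : f x.length - i = f x.length - (i + 1) + 1 := by omega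
      refine ⟨by simp [st], (exec_pop rfl).seq (exec_ucall hQ ?_)⟩
      simp only [List.getD_cons_zero, List.getD_cons_succ, List.set_cons_zero, List.set_cons_succ]
      rw [ones_append_ones, e, add_mul, one_mul, add_comm]
      rfl)
  simpa using h

/-- Register `3` starts with a single bit and is doubled once for every bit of `f n`; each doubling
is charged with the final size. -/
theorem UComputes.two_pow {P : Prog} (hP : UComputes P f τ) :
    UComputes (.seq (ucall P 5 0 2) (.seq (.push 3 true)
      (.seq (.loop 2 (.seq (.pop 2) (double 3 4))) (move 3 1))))
      (fun n => 2 ^ f n)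
      (fun n => τ n + (1 + (f n * (1 + (12 * 2 ^ f n + 2) + 1) + 1 + (4 * 2 ^ f n + 1)))) := by
  intro O x u
  rw [st_pad [x, u] 3, st_pad [x, _] 3]
  refine (exec_ucall hP).seq ((exec_push rfl).seq (Exec.seq ?_ ((exec_move
    (L := [x, u, [], ones (2 ^ f x.length), []])).of_eq ?_ (by simp))))
  · have h := exec_loop_seq (O := O) (P := .seq (.pop 2) (double 3 4)) (r := 2)
      (k := 1 + (12 * 2 ^ f x.length + 2)) (n := f x.length)
      (fun i => st [x, u, ones i, ones (2 ^ (f x.length - i)), []]) (by simp [st])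
      (fun i hi => by
        have e : f x.length - i = f x.length - (i + 1) + 1 := by omega
        refine ⟨by simp [st], (exec_pop rfl).seq ((exec_double ?_).mono ?_)⟩
        · simp [e, pow_succ, mul_comm]
        · simp only [List.getD_cons_zero, List.getD_cons_succ, List.set_cons_zero,
            List.set_cons_succ, List.length_replicate]
          have := Nat.pow_le_pow_right (n := 2) (by norm_num)
            (Nat.sub_le (f x.length) (i + 1))
          omega)
    simpa using h
  · simp

/-- Boundedness by a function from a class. -/
def Bdd (T : Set (ℕ → ℕ)) (f : ℕ → ℕ) : Prop := ∃ t ∈ T, ∀ n, f n ≤ t n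

theorem Bdd.of_mem (h : f ∈ T) : Bdd T f := ⟨f, h, fun _ => le_rfl⟩

theorem Bdd.mono (h : Bdd T g) (hfg : ∀ n, f n ≤ g n) : Bdd T f := by
  obtain ⟨t, ht, h⟩ := h
  exact ⟨t, ht, fun n => (hfg n).trans (h n)⟩

/-- The properties of a class of time bounds that are needed for elementary constructions. -/
structure TimeClass (T : Set (ℕ → ℕ)) : Prop where
  const : ∀ c, Bdd T fun _ => c
  id : Bdd T fun n => n
  add : ∀ {f g}, Bdd T f → Bdd T g → Bdd T fun n => f n + g n
  mul : ∀ {f g}, Bdd T f → Bdd T g → Bdd T fun n => f n * g n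

theorem timeClass_poly : TimeClass polyBounds where
  const c := .of_mem ⟨.C c, by simp⟩
  id := .of_mem ⟨.X, by simp⟩
  add := by
    rintro f g ⟨_, ⟨p, hp⟩, hf⟩ ⟨_, ⟨q, hq⟩, hg⟩
    exact ⟨_, ⟨p + q, fun n => rfl⟩, fun n => by
      simpa [← hp, ← hq] using add_le_add (hf n) (hg n)⟩
  mul := by
    rintro f g ⟨_, ⟨p, hp⟩, hf⟩ ⟨_, ⟨q, hq⟩, hg⟩
    exact ⟨_, ⟨p * q, fun n => rfl⟩, fun n => by
      simpa [← hp, ← hq] using Nat.mul_le_mul (hf n) (hg n)⟩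

theorem timeClass_exp : TimeClass expBounds where
  const c := ⟨_, ⟨0, c, fun n => rfl⟩, fun n => by simpa using Nat.lt_two_pow_self.le⟩
  id := ⟨_, ⟨1, 0, fun n => rfl⟩, fun n => by simpa using Nat.lt_two_pow_self.le⟩
  add := by
    rintro f g ⟨t, ⟨c, d, ht⟩, hf⟩ ⟨t', ⟨c', d', ht'⟩, hg⟩
    refine ⟨_, ⟨c + c', d + d' + 1, fun n => rfl⟩, fun n => ?_⟩
    have h1 : t n ≤ 2 ^ ((c + c') * n + (d + d')) := by
      rw [ht]; exact Nat.pow_le_pow_right (by norm_num) (by nlinarith)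
    have h2 : t' n ≤ 2 ^ ((c + c') * n + (d + d')) := by
      rw [ht']; exact Nat.pow_le_pow_right (by norm_num) (by nlinarith)
    have := hf n
    have := hg n
    rw [← add_assoc, pow_succ]
    show f n + g n ≤ _
    omega
  mul := by
    rintro f g ⟨t, ⟨c, d, ht⟩, hf⟩ ⟨t', ⟨c', d', ht'⟩, hg⟩
    refine ⟨_, ⟨c + c', d + d', fun n => rfl⟩, fun n => (Nat.mul_le_mul (hf n) (hg n)).trans ?_⟩
    rw [ht, ht', ← pow_add]
    exact Nat.pow_le_pow_right (by norm_num) (by nlinarith)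

theorem monotone_eval (p : Polynomial ℕ) : Monotone fun n => p.eval n := by
  intro m n h
  simp only [Polynomial.eval_eq_sum, Polynomial.sum]
  gcongr

theorem TimeClass.eval_comp (hT : TimeClass T) (p : Polynomial ℕ) (hg : Bdd T g) :
    Bdd T fun n => p.eval (g n) := by
  induction p using Polynomial.induction_on' with
  | add p q hp hq => simpa using hT.add hp hq
  | monomial d c =>
    simp only [Polynomial.eval_monomial]
    refine hT.mul (hT.const c) ?_
    induction d with
    | zero => simpa using hT.const 1
    | succ d ih => simpa [pow_succ] using hT.mul ih hg

/-- A polynomial-time subroutine may be run on words of length bounded in `T`. For `expBounds` this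
says that a polynomial in `2 ^ O(n)` is again `2 ^ O(n)`. -/
theorem TimeClass.comp (hT : TimeClass T) (hf : Bdd polyBounds f) (hg : Bdd T g) :
    Bdd T fun n => f (g n) := by
  obtain ⟨t, ⟨p, hp⟩, hf⟩ := hf
  exact (hT.eval_comp p hg).mono fun n => by rw [← hp]; exact hf _

/-- The function `f` can be computed in unary in a time bound from `T`. -/
def UComputable (T : Set (ℕ → ℕ)) (f : ℕ → ℕ) : Prop := ∃ P τ, Bdd T τ ∧ UComputes P f τ

theorem uComputable_poly (hT : TimeClass T) (p : Polynomial ℕ) :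
    UComputable T fun n => p.eval n := by
  induction p using Polynomial.induction_on' with
  | add p q hp hq =>
    obtain ⟨P, τ, hτ, hP⟩ := hp
    obtain ⟨Q, τ', hτ', hQ⟩ := hq
    exact ⟨_, _, hT.add hτ hτ', by simpa using hP.add hQ⟩
  | monomial d c =>
    simp only [Polynomial.eval_monomial]
    induction d with
    | zero =>
      obtain ⟨P, hP⟩ := UComputes.const c
      exact ⟨P, _, hT.const (c + 1), by simpa using hP⟩
    | succ d ih =>
      obtain ⟨P, τ, hτ, hP⟩ := ih
      obtain ⟨Q, hQ⟩ := UComputes.id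
      refine ⟨_, _, ?_, by simpa [pow_succ, mul_assoc] using hP.mul hQ⟩
      have hm : Bdd T fun n => n ^ d := by
        simpa using hT.eval_comp (.X ^ d) hT.id
      apply_rules [hT.const, hT.id, hT.add, hT.mul]

theorem uComputable_exp (c d : ℕ) : UComputable expBounds fun n => 2 ^ (c * n + d) := by
  have hT := timeClass_exp
  obtain ⟨P, τ, hτ, hP⟩ := uComputable_poly hT (.C c * .X + .C d)
  simp only [Polynomial.eval_add, Polynomial.eval_mul, Polynomial.eval_C, Polynomial.eval_X] at hP
  have h : Bdd expBounds fun n => 2 ^ (c * n + d) := .of_mem ⟨c, d, fun n => rfl⟩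
  exact ⟨_, _, by apply_rules [hT.const, hT.id, hT.add, hT.mul], hP.two_pow⟩

theorem uComputable_of_mem_polyBounds (hf : f ∈ polyBounds) : UComputable polyBounds f := by
  obtain ⟨p, hp⟩ := hf
  obtain rfl : f = fun n => p.eval n := funext hp
  exact uComputable_poly timeClass_poly p

theorem uComputable_of_mem_expBounds (hf : f ∈ expBounds) : UComputable expBounds f := by
  obtain ⟨c, d, hp⟩ := hf
  obtain rfl : f = fun n => 2 ^ (c * n + d) := funext hp
  exact uComputable_exp c d

theorem TimeClass.callCost (hT : TimeClass T) (P : Prog) (hf : Bdd T f) (hg : Bdd T g) :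
    Bdd T fun n => callCost P (f n) (g n) := by
  unfold UntrustedAdvice.callCost
  apply_rules [hT.const, hT.id, hT.add, hT.mul]

/-! ### Elementary inclusions: ignoring advice, guessing advice, complements. -/

variable {L : Set (List Bool)}

theorem answer_eq_true {x : List Bool} : answer L x = true ↔ x ∈ L := by simp [answer]

theorem answer_compl (x : List Bool) : answer Lᶜ x = !answer L x := by
  by_cases h : x ∈ L <;> simp [answer, h]

/-- Replace the answer of a program by its negation. -/
def flip (P : Prog) : Prog := .seq P (.branch 0 .skip (.push 0 true) (.push 0 false))

theorem outputsIn_flip {x w : List Bool} {t : ℕ} {o : Option Bool} (h : OutputsIn O P x w t o) :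
    OutputsIn O (flip P) x w (t + 2) (o.map not) := by
  obtain ⟨s, k, hk, hr, rfl⟩ := h
  rcases hs : s 0 with _ | ⟨_ | _, u⟩
  · exact ⟨_, k + (1 + 1), by omega, hr.seq (.branch_empty (by simp [hs]) (.skip s)), by simp [hs]⟩
  · exact ⟨_, k + (1 + 1), by omega, hr.seq (.branch_false (by simp [hs]) (.push 0 true s)), by simp⟩
  · exact ⟨_, k + (1 + 1), by omega, hr.seq (.branch_true (by simp [hs]) (.push 0 false s)), by simp⟩

/-- Rename the registers such that register `1` is not used. -/
def detach (P : Prog) : Prog := P.map fun r => if r = 0 then 0 else r + 1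

/-- A deterministic decider is only known to work when register `1` starts empty. After the
renaming, the old register `1` is one that starts empty, and `w` is never touched. -/
theorem outputsIn_detach {x : List Bool} {t : ℕ} {o : Option Bool} (h : OutputsIn O P x [] t o)
    (w : List Bool) : OutputsIn O (detach P) x w t o := by
  obtain ⟨s, k, hk, hr, rfl⟩ := h
  obtain ⟨t', h1, -, h3⟩ := hr.map (σ := fun r => if r = 0 then 0 else r + 1)
    (by intro q r h; dsimp only at h; split_ifs at h <;> omega) (initStore x w) (by
      rintro (_ | _ | r) <;> simp [initStore])
  exact ⟨t', k, hk, h3, by rw [← h1 0]; rfl⟩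

theorem dTime_subset_yTime : DTime T ⊆ YTime T := by
  rintro L ⟨P, t, ht, h⟩
  -- The advice is filler. Its length is `t n` only because `t` is a member of `T` that is at hand.
  refine ⟨detach P, t, ht, t, ht, fun n => ⟨⟨List.replicate (t n) true, by simp, ?_⟩, ?_⟩⟩
  · rintro x rfl
    exact outputsIn_detach (h x) _
  · rintro x y rfl
    exact .inl (outputsIn_detach (h x) _)

/-- The advice serves as the guess: good advice leads to acceptance of every member, and no advice
leads to acceptance of a non-member. -/
theorem yTime_subset_nTime : YTime T ⊆ NTimeOracle T ∅ := by
  rintro L ⟨A, p, hp, t, ht, h⟩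
  refine ⟨A, p, hp, t, ht, fun x w _ => ?_, fun x => ⟨fun hx => ?_, ?_⟩⟩
  · exact ((h x.length).2 x w rfl).elim (fun h => ⟨_, h⟩) fun h => ⟨_, h⟩
  · obtain ⟨y, hy, h⟩ := (h x.length).1
    exact ⟨y, hy, by simpa [answer_eq_true.mpr hx] using h x rfl⟩
  · rintro ⟨w, -, hw⟩
    rcases (h x.length).2 x w rfl with h | h
    · simpa [answer_eq_true] using h.det hw
    · simpa using h.det hw

theorem TimeClass.compl_mem_yTime (hT : TimeClass T) (hL : L ∈ YTime T) : Lᶜ ∈ YTime T := by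
  obtain ⟨A, p, hp, t, ht, h⟩ := hL
  obtain ⟨t', ht', hle⟩ := hT.add (.of_mem ht) (hT.const 2)
  refine ⟨flip A, p, hp, t', ht', fun n => ⟨?_, fun x y hx => ?_⟩⟩
  · obtain ⟨y, hy, h⟩ := (h n).1
    refine ⟨y, hy, fun x hx => ?_⟩
    simpa [answer_compl] using (outputsIn_flip (h x hx)).mono (hle n)
  · rcases (h n).2 x y hx with h | h
    · exact .inl (by simpa [answer_compl] using (outputsIn_flip h).mono (hle n))
    · exact .inr (by simpa using (outputsIn_flip h).mono (hle n))

theorem classYE_subset : classYE ⊆ classNE ∩ coClass classNE := fun _ hL =>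
  ⟨yTime_subset_nTime hL, yTime_subset_nTime (timeClass_exp.compl_mem_yTime hL)⟩

/-! ### Advice as a table of witnesses: `NE ∩ coNE ⊆ YE`. -/

/-- Append the top bit of register `r` to the binary expansion of the length of register `v`. -/
def shiftBit (r v t : ℕ) : Prog :=
  .seq (double v t) (.seq (.branch r .skip .skip (.push v true)) (.pop r))

theorem exec_shiftBit {M M' : List (List Bool)} {r v t : ℕ}
    (h : (M.set v (ones (2 * (M.getD v []).length + ((M.getD r []).headD false).toNat))).set r
      (M.getD r []).tail = M' := by rfl)
    (ht : M.getD t [] = [] := by rfl) (hvt : v ≠ t := by simp) (hvr : v ≠ r := by simp)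
    (hr : r < M.length := by simp) (hv : v < M.length := by simp) :
    Exec O (shiftBit r v t) (st M) (st M') (12 * (M.getD v []).length + 5) := by
  subst h
  have h1 := exec_double (O := O) (L := M) (r := v) (t := t) rfl ht hvt hv
  set M₁ := M.set v (ones (2 * (M.getD v []).length)) with hM₁
  have hr₁ : M₁.getD r [] = M.getD r [] := by simp [hM₁, List.getD_eq_getElem?_getD, hvr]
  have hv₁ : M₁.getD v [] = ones (2 * (M.getD v []).length) := by
    simp [hM₁, List.getD_eq_getElem?_getD, hv]
  have h2 : Exec O (.branch r .skip .skip (.push v true)) (st M₁) (st (M.set v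
      (ones (2 * (M.getD v []).length + ((M.getD r []).headD false).toNat)))) (1 + 1) := by
    refine exec_branch_st (fun h => ?_) (fun u h => ?_) (fun u h => ?_) <;> rw [hr₁] at h <;>
      rw [h]
    · exact exec_skip
    · exact exec_skip
    · refine exec_push ?_ (by simpa [hM₁] using hv)
      rw [hv₁, hM₁]
      simp [List.replicate_succ]
  refine (h1.seq (h2.seq (exec_pop ?_ (by simpa using hr)))).mono (by omega)
  simp [List.getD_eq_getElem?_getD, hvr]

/-- The number with the given binary digits, continuing the digits of `v`. -/
def binVal (z : List Bool) (v : ℕ) : ℕ := z.foldl (fun v b => 2 * v + b.toNat) v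

theorem binVal_lt (z : List Bool) (v : ℕ) : binVal z v < (v + 1) * 2 ^ z.length := by
  induction z generalizing v with
  | nil => simp [binVal]
  | cons b z ih =>
    refine (ih _).trans_le ?_
    rw [List.length_cons, pow_succ, mul_comm _ 2, ← mul_assoc]
    gcongr
    cases b <;> simp <;> omega

theorem le_binVal (z : List Bool) (v : ℕ) : v ≤ binVal z v := by
  induction z generalizing v with
  | nil => simp [binVal]
  | cons b z ih => exact le_trans (show v ≤ 2 * v + b.toNat by omega) (ih _)

/-- The starting values are compared along with the words: by induction `2 * v + b = 2 * v' + b'`,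
and parity separates the digit from the rest. Thus `binVal x 0` can index the table entry of `x`. -/
theorem binVal_inj {z z' : List Bool} (h : z.length = z'.length) {v v' : ℕ}
    (hv : binVal z v = binVal z' v') : z = z' ∧ v = v' := by
  induction z generalizing z' v v' with
  | nil =>
    obtain rfl := List.length_eq_zero_iff.mp h.symm
    exact ⟨rfl, hv⟩
  | cons b z ih =>
    rcases z' with _ | ⟨b', z'⟩
    · simp at h
    · obtain ⟨rfl, h2⟩ := ih (Nat.succ.inj h)
        (show binVal z (2 * v + b.toNat) = binVal z' (2 * v' + b'.toNat) from hv)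
      cases b <;> cases b' <;> simp at h2 ⊢ <;> omega

/-- The concatenation of blocks of equal length. -/
theorem exists_blocks (blk : ℕ → List Bool) {B : ℕ} (hB : ∀ v, (blk v).length = B) (m : ℕ) :
    ∃ y : List Bool, y.length = m * B ∧ ∀ v < m, ∃ r, y.drop (v * B) = blk v ++ r := by
  induction m with
  | zero => exact ⟨[], by simp⟩
  | succ m ih =>
    obtain ⟨y, hy, h⟩ := ih
    refine ⟨y ++ blk m, by simp [hy, hB, add_mul], fun v hv => ?_⟩
    rcases Nat.lt_succ_iff_lt_or_eq.mp hv with hv | rfl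
    · obtain ⟨r, hr⟩ := h v hv
      refine ⟨r ++ blk m, ?_⟩
      rw [List.drop_append_of_le_length (by rw [hy]; gcongr), hr, List.append_assoc]
    · exact ⟨[], by rw [← hy]; simp⟩

/-- The machine for a language with verifiers `V` for membership and `W` for non-membership: it
looks up a witness for each verifier in the part of the advice that belongs to the input, where
`P` and `Q` compute the lengths of the witnesses. -/
def lookupProg (V W P Q : Prog) : Prog :=
  .seq (copy 0 2 4) <| .seq (.loop 2 (shiftBit 2 3 4)) <|
  .seq (.loop 3 (.seq (.pop 3) (.seq (ucall P 10 0 5) (.seq (ucall Q 10 0 5)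
    (.seq (takeBits 5 1 4) (clear 4)))))) <|
  .seq (ucall P 10 0 5) <| .seq (takeBits 5 1 6) <|
  .seq (ucall Q 10 0 5) <| .seq (takeBits 5 1 7) <|
  .seq (call V 10 0 6 8) <| .seq (call W 10 0 7 9) <|
  .seq (clear 0) <|
  .branch 8 (.branch 9 .skip .skip (.push 0 false)) (.branch 9 .skip .skip (.push 0 false))
    (.push 0 true)

theorem exec_binVal {x y : List Bool} {M : ℕ} (z : List Bool) (v : ℕ) (hM : binVal z v ≤ M) :
    Exec O (.loop 2 (shiftBit 2 3 4)) (st [x, y, z, ones v, [], [], [], [], [], []])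
      (st [x, y, [], ones (binVal z v), [], [], [], [], [], []]) (z.length * (12 * M + 6) + 1) := by
  induction z generalizing v with
  | nil => exact (exec_loop_done rfl).mono (by simp)
  | cons b z ih =>
    have h1 := exec_shiftBit (O := O) (r := 2) (v := 3) (t := 4)
      (M := [x, y, b :: z, ones v, [], [], [], [], [], []])
      (M' := [x, y, z, ones (2 * v + b.toNat), [], [], [], [], [], []]) (by simp)
    refine (exec_loop_step (by simp [st]) h1 (ih _ hM)).mono ?_
    have := (le_binVal (b :: z) v).trans hM
    simp [add_mul]
    omega

/-- The answer of a machine that runs verifiers for membership and non-membership. -/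
def verdict (o o' : Option Bool) : Option Bool :=
  if o = some true then some true else if o' = some true then some false else none

/-- A bound for the number of steps of `lookupProg`. -/
def lookupCost (V W : Prog) (p q t u τ τ' : ℕ → ℕ) (n : ℕ) : ℕ :=
  (9 * n + 2) + (n * (12 * 2 ^ n + 6) + 1 +
  (2 ^ n * (1 + (τ n + (τ' n + (5 * (p n + q n) + 1 + (2 * (p n + q n) + 1)))) + 1) + 1 +
  (τ n + (5 * p n + 1 + (τ' n + (5 * q n + 1 +
  (callCost V (n + p n) (t n) + (callCost W (n + q n) (u n) + (2 * n + 1 + 3)))))))))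

theorem outputsIn_lookupProg {V W : Prog} {p q : ℕ → ℕ} (hP : UComputes P p τ)
    (hQ : UComputes Q q τ') {t u : ℕ → ℕ} {x y y₁ : List Bool} {o o' : Option Bool}
    (hy₁ : y₁ = y.drop (binVal x 0 * (p x.length + q x.length)))
    (ho : OutputsIn ∅ V x (ptake (p x.length) y₁).reverse (t x.length) o)
    (ho' : OutputsIn ∅ W x (ptake (q x.length) (y₁.drop (p x.length))).reverse (u x.length) o') :
    OutputsIn ∅ (lookupProg V W P Q) x y (lookupCost V W p q t u τ τ' x.length) (verdict o o') := by
  set n := x.length with hn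
  set w := (ptake (p n) y₁).reverse with hw
  set w' := (ptake (q n) (y₁.drop (p n))).reverse with hw'
  set v := binVal x 0 with hv
  have hv2 : v ≤ 2 ^ n := by simpa using (binVal_lt x 0).le
  set B := p n + q n with hB
  have h1 : Exec ∅ (copy 0 2 4) (st [x, y, [], [], [], [], [], [], [], []])
    (st [x, y, x, [], [], [], [], [], [], []]) (9 * n + 2) := exec_copy (by simp)
  have h2 := exec_binVal (O := ∅) (x := x) (y := y) (M := 2 ^ n) x 0 hv2
  -- The index `i` counts the blocks still to be skipped. One pass computes the block length `B`
  -- afresh and discards `B` bits of advice.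
  have h3 := exec_loop_seq (O := ∅) (P := .seq (.pop 3) (.seq (ucall P 10 0 5)
    (.seq (ucall Q 10 0 5) (.seq (takeBits 5 1 4) (clear 4))))) (r := 3) (n := v)
    (k := 1 + (τ n + (τ' n + (5 * B + 1 + (2 * B + 1)))))
    (fun i => st [x, y.drop ((v - i) * B), [], ones i, [], [], [], [], [], []]) (by simp [st])
    (fun i hi => by
      set z := y.drop ((v - (i + 1)) * B) with hz
      have e : y.drop ((v - i) * B) = z.drop B := by
        rw [hz, List.drop_drop, show v - i = v - (i + 1) + 1 by omega, add_mul, one_mul]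
      have h1 : Exec ∅ (takeBits 5 1 4) (st [x, z, [], ones i, [], ones B, [], [], [], []])
        (st [x, z.drop B, [], ones i, (ptake B z).reverse, [], [], [], [], []]) (5 * B + 1) :=
          (exec_takeBits (by simp)).mono (by simp)
      have h2 : Exec ∅ (clear 4)
        (st [x, z.drop B, [], ones i, (ptake B z).reverse, [], [], [], [], []])
        (st [x, z.drop B, [], ones i, [], [], [], [], [], []]) (2 * B + 1) :=
          (exec_clear rfl).mono (by simp)
      rw [e]
      refine ⟨by simp [st], (exec_pop rfl).seq ((exec_ucall hP rfl).seq
        ((exec_ucall hQ ?_).seq (h1.seq h2)))⟩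
      simp [hB, add_comm, hn])
  have h4 : Exec ∅ (ucall P 10 0 5) (st [x, y₁, [], [], [], [], [], [], [], []])
    (st [x, y₁, [], [], [], ones (p n), [], [], [], []]) (τ n) := exec_ucall hP (by simp [hn])
  have h5 : Exec ∅ (takeBits 5 1 6) (st [x, y₁, [], [], [], ones (p n), [], [], [], []])
    (st [x, y₁.drop (p n), [], [], [], [], w, [], [], []]) (5 * p n + 1) :=
      (exec_takeBits (by simp [hw])).mono (by simp)
  have h6 : Exec ∅ (ucall Q 10 0 5) (st [x, y₁.drop (p n), [], [], [], [], w, [], [], []])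
    (st [x, y₁.drop (p n), [], [], [], ones (q n), w, [], [], []]) (τ' n) :=
      exec_ucall hQ (by simp [hn])
  have h7 : Exec ∅ (takeBits 5 1 7)
    (st [x, y₁.drop (p n), [], [], [], ones (q n), w, [], [], []])
    (st [x, (y₁.drop (p n)).drop (q n), [], [], [], [], w, w', [], []]) (5 * q n + 1) :=
      (exec_takeBits (by simp [hw'])).mono (by simp)
  set y₂ := (y₁.drop (p n)).drop (q n)
  have h8 : Exec ∅ (call V 10 0 6 8) (st [x, y₂, [], [], [], [], w, w', [], []])
    (st [x, y₂, [], [], [], [], w, w', o.toList, []]) (callCost V (n + p n) (t n)) :=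
      (exec_call ho (by simp)).mono (by simp [hw, hn])
  have h9 : Exec ∅ (call W 10 0 7 9) (st [x, y₂, [], [], [], [], w, w', o.toList, []])
    (st [x, y₂, [], [], [], [], w, w', o.toList, o'.toList]) (callCost W (n + q n) (u n)) :=
      (exec_call ho' (by simp)).mono (by simp [hw', hn])
  have h10 : Exec ∅ (clear 0) (st [x, y₂, [], [], [], [], w, w', o.toList, o'.toList])
    (st [[], y₂, [], [], [], [], w, w', o.toList, o'.toList]) (2 * n + 1) := exec_clear rfl
  have h11 : Exec ∅ (.branch 8 (.branch 9 .skip .skip (.push 0 false))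
      (.branch 9 .skip .skip (.push 0 false)) (.push 0 true))
      (st [[], y₂, [], [], [], [], w, w', o.toList, o'.toList])
      (st [(verdict o o').toList, y₂, [], [], [], [], w, w', o.toList, o'.toList]) (2 + 1) := by
    have hno : o ≠ some true → Exec ∅ (.branch 9 .skip .skip (.push 0 false))
        (st [[], y₂, [], [], [], [], w, w', o.toList, o'.toList])
        (st [(verdict o o').toList, y₂, [], [], [], [], w, w', o.toList, o'.toList]) (1 + 1) := by
      intro h
      rcases o' with _ | _ | _ <;> refine exec_branch_st (fun h => ?_) (fun u h => ?_)
        (fun u h => ?_) <;> simp_all [verdict, exec_skip, exec_push]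
    refine exec_branch_st (fun h => hno ?_) (fun u h => hno ?_) (fun u h => ?_)
    · rintro rfl; simp at h
    · rintro rfl; simp at h
    · rcases o with _ | _ | _ <;> simp_all [verdict]
      exact (exec_push rfl).mono (by omega)
  -- The number `v` of passes depends on the input itself; replacing it by `2 ^ n` gives a bound in
  -- terms of the length alone.
  have h3' : Exec ∅ _ (st [x, y, [], ones v, [], [], [], [], [], []])
      (st [x, y₁, [], [], [], [], [], [], [], []]) _ := (by simpa [hy₁] using h3 :
      Exec ∅ _ _ _ (v * (1 + (τ n + (τ' n + (5 * B + 1 + (2 * B + 1)))) + 1) + 1)).mono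
    (l := 2 ^ n * (1 + (τ n + (τ' n + (5 * B + 1 + (2 * B + 1)))) + 1) + 1) (by gcongr)
  have h12 := h1.seq (h2.seq (h3'.seq
    (h4.seq (h5.seq (h6.seq (h7.seq (h8.seq (h9.seq (h10.seq h11)))))))))
  refine (Exec.mono h12 ?_).outputsIn (n := 8) (by rcases verdict o o' with _ | _ <;> simp)
  simp only [lookupCost, ← hB, ← hn]
  omega

theorem subset_classYE : classNE ∩ coClass classNE ⊆ classYE := by
  rintro L ⟨⟨V, p, hp, t, ht, hV, hVL⟩, ⟨W, q, hq, u, hu, hW, hWL⟩⟩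
  obtain ⟨P, τ, hτ, hP⟩ := uComputable_of_mem_expBounds hp
  obtain ⟨Q, τ', hτ', hQ⟩ := uComputable_of_mem_expBounds hq
  have hT := timeClass_exp
  have hpb := Bdd.of_mem hp
  have hqb := Bdd.of_mem hq
  have htb := Bdd.of_mem ht
  have hub := Bdd.of_mem hu
  have h2 : Bdd expBounds fun n => 2 ^ n := .of_mem ⟨1, 0, by simp⟩
  obtain ⟨s, hs, hsb⟩ : Bdd expBounds fun n => 2 ^ n * (p n + q n) := by
    repeat' first | assumption | exact hT.const _ | exact hT.id | apply hT.add | apply hT.mul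
  obtain ⟨r, hr, hrb⟩ : Bdd expBounds (lookupCost V W p q t u τ τ') := by
    unfold lookupCost
    repeat' first | assumption | exact hT.const _ | exact hT.id | apply hT.callCost |
      apply hT.add | apply hT.mul
  -- Only one of the two words is a genuine witness. The other is filler of the right length, which
  -- gives all table entries the same size.
  have wit : ∀ x, ∃ b : List Bool × List Bool, b.1.length = p x.length ∧ b.2.length = q x.length ∧
      (x ∈ L → OutputsIn ∅ V x b.1 (t x.length) (some true)) ∧
      (x ∉ L → OutputsIn ∅ W x b.2 (u x.length) (some true)) := by
    intro x
    by_cases hx : x ∈ L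
    · obtain ⟨w, hw, h⟩ := (hVL x).mp hx
      exact ⟨(w, List.replicate (q x.length) true), hw, by simp, fun _ => h, fun h => absurd hx h⟩
    · obtain ⟨w, hw, h⟩ := (hWL x).mp hx
      exact ⟨(List.replicate (p x.length) true, w), by simp, hw, fun h => absurd h hx, fun _ => h⟩
  choose b hb1 hb2 hbV hbW using wit
  -- The verifiers are known to halt only on guesses of the prescribed lengths. Since `ptake` pads
  -- with `false`, such guesses are produced from advice of any length.
  have run : ∀ x y : List Bool, ∃ o o', OutputsIn ∅ V x (ptake (p x.length)
        (y.drop (binVal x 0 * (p x.length + q x.length)))).reverse (t x.length) o ∧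
      OutputsIn ∅ W x (ptake (q x.length) ((y.drop (binVal x 0 *
        (p x.length + q x.length))).drop (p x.length))).reverse (u x.length) o' ∧
      OutputsIn ∅ (lookupProg V W P Q) x y (r x.length) (verdict o o') := by
    intro x y
    obtain ⟨o, ho⟩ := hV x (ptake (p x.length)
      (y.drop (binVal x 0 * (p x.length + q x.length)))).reverse (by simp)
    obtain ⟨o', ho'⟩ := hW x (ptake (q x.length)
      ((y.drop (binVal x 0 * (p x.length + q x.length))).drop (p x.length))).reverse (by simp)
    exact ⟨o, o', ho, ho', (outputsIn_lookupProg hP hQ rfl ho ho').mono (hrb _)⟩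
  have hVt : ∀ {x w : List Bool}, w.length = p x.length →
      OutputsIn ∅ V x w (t x.length) (some true) → x ∈ L := fun hw h => (hVL _).mpr ⟨_, hw, h⟩
  have hWt : ∀ {x w : List Bool}, w.length = q x.length →
      OutputsIn ∅ W x w (u x.length) (some true) → x ∉ L := fun hw h => (hWL _).mpr ⟨_, hw, h⟩
  refine ⟨lookupProg V W P Q, s, hs, r, hr, fun n => ⟨?_, ?_⟩⟩
  · classical
    -- Entry `v` holds the witnesses for the input with index `v`. They are stored reversed because
    -- `takeBits` reverses what it reads.
    obtain ⟨y, hy, hblk⟩ := exists_blocks (B := p n + q n) (fun v =>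
      if h : ∃ x : List Bool, x.length = n ∧ binVal x 0 = v then
        (b h.choose).1.reverse ++ (b h.choose).2.reverse else List.replicate (p n + q n) true)
      (by
        intro v
        split_ifs with h
        · simp [hb1, hb2, h.choose_spec.1]
        · simp) (2 ^ n)
    -- The advice length has to be exactly a member of `expBounds`, so the table is filled up to the
    -- bound `s n`.
    refine ⟨y ++ List.replicate (s n - y.length) true, ?_, ?_⟩
    · have := hsb n
      simp only [List.length_append, List.length_replicate, hy]
      simp only at this
      omega
    · rintro x rfl
      have hv : binVal x 0 < 2 ^ x.length := by simpa using binVal_lt x 0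
      obtain ⟨z, hz⟩ := hblk _ hv
      have hex : ∃ x' : List Bool, x'.length = x.length ∧ binVal x' 0 = binVal x 0 := ⟨x, rfl, rfl⟩
      rw [dif_pos hex, (binVal_inj hex.choose_spec.1 hex.choose_spec.2).1] at hz
      obtain ⟨o, o', ho, ho', h⟩ := run x (y ++ List.replicate (s x.length - y.length) true)
      rw [List.drop_append_of_le_length (by rw [hy]; gcongr), hz] at ho ho'
      simp only [List.append_assoc] at ho ho'
      have e1 := ptake_append (b x).1.reverse ((b x).2.reverse ++
        (z ++ List.replicate (s x.length - y.length) true))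
      have e2 := ptake_append (b x).2.reverse (z ++ List.replicate (s x.length - y.length) true)
      rw [List.length_reverse, hb1] at e1
      rw [List.length_reverse, hb2] at e2
      rw [e1, List.reverse_reverse] at ho
      rw [List.drop_left' (by simp [hb1]), e2, List.reverse_reverse] at ho'
      convert h
      by_cases hx : x ∈ L
      · rw [ho.det (hbV x hx)]
        simp [verdict, answer, hx]
      -- The first verifier runs on filler here, but it cannot accept a non-member whatever it is
      -- given.
      · have : o ≠ some true := by
          rintro rfl
          exact hx (hVt (hb1 x) ho)
        rw [ho'.det (hbW x hx)]
        simp [verdict, answer, hx, this]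
  · rintro x y rfl
    obtain ⟨o, o', ho, ho', h⟩ := run x y
    unfold verdict at h
    split_ifs at h with h1 h2
    · subst h1
      have hx := hVt (by simp) ho
      exact .inl (by simpa [answer, hx] using h)
    · subst h2
      have hx := hWt (by simp) ho'
      exact .inl (by simpa [answer, hx] using h)
    · exact .inr h

/-! ### Padding: from `P = YP` to `E = NE ∩ coNE`. -/

theorem bdd_comp_log (hf : Bdd expBounds f) : Bdd polyBounds fun m => f (Nat.log 2 m) := by
  obtain ⟨t, ⟨c, d, ht⟩, hf⟩ := hf
  -- With `l = log m`, `2 ^ (c * l + d) = 2 ^ d * (2 ^ l) ^ c` and `2 ^ l ≤ m + 1`; the summand `1`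
  -- takes care of `m = 0`.
  refine ⟨_, ⟨.C (2 ^ d) * (.X + .C 1) ^ c, fun _ => rfl⟩, fun m => (hf _).trans ?_⟩
  simp only [ht, Polynomial.eval_mul, Polynomial.eval_pow, Polynomial.eval_add, Polynomial.eval_C,
    Polynomial.eval_X]
  rw [pow_add, pow_mul', mul_comm]
  have := Nat.pow_log_le_add_one 2 m
  gcongr

/-- The words that begin with the reversal of a word of `L`, whose length is the logarithm of the
length of the whole word. -/
def padLang (L : Set (List Bool)) : Set (List Bool) :=
  {z | (ptake (Nat.log 2 z.length) z).reverse ∈ L}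

/-- The machine for `padLang L` made from a machine `A` with advice for `L`, where `P` computes the
advice length. -/
def unpadProg (A P : Prog) : Prog :=
  .seq (copy 0 2 4) <| .seq (halve 2 4 5) <| .seq (.pop 5) <|
  .seq (.loop 2 (.seq (.push 3 true) (.seq (halve 2 4 5) (.pop 5)))) <|
  .seq (takeBits 3 0 5) <| .seq (ucall P 9 5 6) <| .seq (takeBits 6 1 7) <|
  .seq (call A 9 5 7 8) <| .seq (clear 0) (move 8 0)

/-- Register `2` holds `m / 2` instead of `m`. It is nonempty exactly when `m ≥ 2`, which is when
the logarithm of `m` exceeds that of `m / 2` by one. -/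
theorem exec_log {z y : List Bool} {N : ℕ} (m : ℕ) (hm : m ≤ N) (u : List Bool) :
    Exec O (.loop 2 (.seq (.push 3 true) (.seq (halve 2 4 5) (.pop 5))))
      (st [z, y, ones (m / 2), u, [], [], [], [], []])
      (st [z, y, [], ones (Nat.log 2 m) ++ u, [], [], [], [], []]) (m * (5 * N + 11) + 1) := by
  induction m using Nat.strong_induction_on generalizing u with
  | _ m ih =>
    rcases lt_or_ge m 2 with h | h
    · rw [Nat.div_eq_of_lt h, Nat.log_of_lt h]
      exact (exec_loop_done rfl).mono (by omega)
    · have h1 : Exec O (halve 2 4 5) (st [z, y, ones (m / 2), true :: u, [], [], [], [], []])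
        (st [z, y, ones (m / 2 / 2), true :: u, [], [decide (m / 2 % 2 = 1)], [], [], []])
        (5 * N + 8) := (exec_halve (by simp)).mono (by simp; omega)
      have h2 := ih (m / 2) (by omega) (by omega) (true :: u)
      have e : Nat.log 2 m = Nat.log 2 (m / 2) + 1 := Nat.log_of_one_lt_of_le (by norm_num) h
      rw [ones_append_cons, ← List.cons_append, ← List.replicate_succ, ← e] at h2
      refine (exec_loop_step (by simp [st]; omega) ((exec_push rfl).seq (h1.seq (exec_pop rfl)))
        h2).mono ?_
      have : m / 2 * (5 * N + 11) + (5 * N + 11) ≤ m * (5 * N + 11) := by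
        rw [← Nat.succ_mul]
        gcongr
        omega
      omega

/-- A bound for the number of steps of `unpadProg`. -/
def unpadCost (A : Prog) (p t τ : ℕ → ℕ) (m : ℕ) : ℕ :=
  9 * m + 2 + (5 * m + 8 + (1 + (m * (5 * m + 11) + 1 + (5 * Nat.log 2 m + 1 +
  (τ (Nat.log 2 m) + (5 * p (Nat.log 2 m) + 1 + (callCost A (Nat.log 2 m + p (Nat.log 2 m))
  (t (Nat.log 2 m)) + (2 * m + 1 + 5))))))))

theorem outputsIn_unpadProg {A : Prog} {p t : ℕ → ℕ} (hP : UComputes P p τ) {z y x : List Bool}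
    {o : Option Bool} (hx : x = (ptake (Nat.log 2 z.length) z).reverse)
    (ho : OutputsIn ∅ A x (ptake (p x.length) y).reverse (t x.length) o) :
    OutputsIn ∅ (unpadProg A P) z y (unpadCost A p t τ z.length) o := by
  set m := z.length with hm
  have hxl : x.length = Nat.log 2 m := by simp [hx]
  have h1 : Exec ∅ (copy 0 2 4) (st [z, y, [], [], [], [], [], [], []])
    (st [z, y, z, [], [], [], [], [], []]) (9 * m + 2) := exec_copy (by simp)
  have h2 : Exec ∅ (halve 2 4 5) (st [z, y, z, [], [], [], [], [], []])
    (st [z, y, ones (m / 2), [], [], [decide (m % 2 = 1)], [], [], []]) (5 * m + 8) :=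
      exec_halve rfl
  have h3 : Exec ∅ (.pop 5) (st [z, y, ones (m / 2), [], [], [decide (m % 2 = 1)], [], [], []])
    (st [z, y, ones (m / 2), [], [], [], [], [], []]) 1 := exec_pop rfl
  have h4 := exec_log (O := ∅) (z := z) (y := y) m le_rfl []
  rw [List.append_nil] at h4
  have h5 : Exec ∅ (takeBits 3 0 5) (st [z, y, [], ones (Nat.log 2 m), [], [], [], [], []])
    (st [z.drop (Nat.log 2 m), y, [], [], [], x, [], [], []]) (5 * Nat.log 2 m + 1) :=
      (exec_takeBits (by simp [hx])).mono (by simp)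
  set z' := z.drop (Nat.log 2 m) with hz'
  have h6 : Exec ∅ (ucall P 9 5 6) (st [z', y, [], [], [], x, [], [], []])
    (st [z', y, [], [], [], x, ones (p x.length), [], []]) (τ x.length) := exec_ucall hP (by simp)
  have h7 : Exec ∅ (takeBits 6 1 7) (st [z', y, [], [], [], x, ones (p x.length), [], []])
    (st [z', y.drop (p x.length), [], [], [], x, [], (ptake (p x.length) y).reverse, []])
    (5 * p x.length + 1) := (exec_takeBits (by simp)).mono (by simp)
  set y' := y.drop (p x.length)
  set w := (ptake (p x.length) y).reverse with hw
  have h8 : Exec ∅ (call A 9 5 7 8) (st [z', y', [], [], [], x, [], w, []])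
    (st [z', y', [], [], [], x, [], w, o.toList])
    (callCost A (x.length + p x.length) (t x.length)) :=
      (exec_call ho (by simp)).mono (by simp [hw])
  have h9 : Exec ∅ (clear 0) (st [z', y', [], [], [], x, [], w, o.toList])
    (st [[], y', [], [], [], x, [], w, o.toList]) (2 * m + 1) :=
      (exec_clear rfl).mono (by simp [hz']; omega)
  have h10 : Exec ∅ (move 8 0) (st [[], y', [], [], [], x, [], w, o.toList])
    (st [o.toList, y', [], [], [], x, [], w, []]) 5 :=
      (exec_move (by rcases o with _ | _ <;> simp)).mono (by rcases o with _ | _ <;> simp)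
  have h := h1.seq (h2.seq (h3.seq (h4.seq (h5.seq (h6.seq (h7.seq (h8.seq (h9.seq h10))))))))
  rw [hxl] at h
  exact h.outputsIn (n := 7) (by rcases o with _ | _ <;> simp)

/-- The length of a padded word determines the length of its relevant part, so advice for the latter
is advice for the former. Bounds `2 ^ O(n)` at `n = log m` are polynomial in `m`. -/
theorem padLang_mem_classYP (hL : L ∈ classYE) : padLang L ∈ classYP := by
  obtain ⟨A, p, hp, t, ht, h⟩ := hL
  obtain ⟨P, τ, hτ, hP⟩ := uComputable_of_mem_expBounds hp
  have hT := timeClass_poly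
  have hpb := bdd_comp_log (Bdd.of_mem hp)
  have htb := bdd_comp_log (Bdd.of_mem ht)
  have hτb := bdd_comp_log hτ
  have hl : Bdd polyBounds fun m => Nat.log 2 m := bdd_comp_log timeClass_exp.id
  obtain ⟨q, hq, hqb⟩ := id hpb
  obtain ⟨r, hr, hrb⟩ : Bdd polyBounds (unpadCost A p t τ) := by
    unfold unpadCost
    repeat' first | assumption | exact hT.const _ | exact hT.id | apply hT.callCost |
      apply hT.add | apply hT.mul
  refine ⟨unpadProg A P, q, hq, r, hr, fun m => ⟨?_, ?_⟩⟩
  · obtain ⟨y, hy, h⟩ := (h (Nat.log 2 m)).1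
    refine ⟨y.reverse ++ List.replicate (q m - y.length) true, ?_, ?_⟩
    · have := hqb m
      simp only [List.length_append, List.length_reverse, List.length_replicate]
      simp only at this
      omega
    · rintro z rfl
      have hxl : ((ptake (Nat.log 2 z.length) z).reverse).length = Nat.log 2 z.length := by simp
      refine (outputsIn_unpadProg hP rfl ?_).mono (hrb _)
      have e := ptake_append y.reverse (List.replicate (q z.length - y.length) true)
      rw [List.length_reverse] at e
      rw [hxl, ← hy, e, List.reverse_reverse]
      exact h _ hxl
  · rintro z y rfl
    have hxl : ((ptake (Nat.log 2 z.length) z).reverse).length = Nat.log 2 z.length := by simp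
    rcases (h _).2 (ptake (Nat.log 2 z.length) z).reverse (ptake (p (Nat.log 2 z.length)) y).reverse
      hxl with h | h
    · exact .inl ((outputsIn_unpadProg (t := t) hP rfl (by rw [hxl]; exact h)).mono (hrb _))
    · exact .inr ((outputsIn_unpadProg (t := t) hP rfl (by rw [hxl]; exact h)).mono (hrb _))

theorem mem_classE_of_padLang (h : padLang L ∈ classP) : L ∈ classE := by
  obtain ⟨B, t, ht, hB⟩ := h
  obtain ⟨P, τ, hτ, hP⟩ := uComputable_exp 1 0
  simp only [one_mul, add_zero] at hP
  have hT := timeClass_exp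
  have h2 : Bdd expBounds fun n => 2 ^ n := .of_mem ⟨1, 0, by simp⟩
  have hn : Bdd expBounds fun n => n + 2 ^ n := hT.add hT.id h2
  have htb := hT.comp (Bdd.of_mem ht) hn
  obtain ⟨r, hr, hrb⟩ : Bdd expBounds fun n =>
      τ n + (4 * n + 1 + callCost B (n + 2 ^ n) (t (n + 2 ^ n))) := by
    repeat' first | assumption | exact hT.const _ | exact hT.id | apply hT.callCost |
      apply hT.add | apply hT.mul
  refine ⟨.seq (ucall P 4 0 2) (.seq (move 0 2) (call B 4 2 3 0)), r, hr, fun x => ?_⟩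
  set n := x.length with hnx
  set z := x.reverse ++ ones (2 ^ n) with hz
  have hzl : z.length = n + 2 ^ n := by simp [hz, hnx]
  -- The padding `2 ^ n` is chosen for this: `2 ^ n ≤ n + 2 ^ n < 2 ^ (n + 1)`.
  have hlog : Nat.log 2 z.length = n := by
    have : n < 2 ^ n := Nat.lt_two_pow_self
    rw [hzl, Nat.log_eq_iff (by norm_num), pow_succ]
    omega
  have hans : answer (padLang L) z = answer L x := by
    rw [Bool.eq_iff_iff, answer_eq_true, answer_eq_true]
    simp only [padLang, Set.mem_ofPred_eq]
    rw [hlog]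
    have e := ptake_append x.reverse (ones (2 ^ n))
    rw [List.length_reverse] at e
    rw [hz, hnx, e, List.reverse_reverse]
  have h1 : Exec ∅ (ucall P 4 0 2) (st [x, [], [], []]) (st [x, [], ones (2 ^ n), []]) (τ n) :=
    exec_ucall hP (by simp [hnx])
  have h2 : Exec ∅ (move 0 2) (st [x, [], ones (2 ^ n), []]) (st [[], [], z, []]) (4 * n + 1) :=
    exec_move rfl
  have h3 : Exec ∅ (call B 4 2 3 0) (st [[], [], z, []]) (st [[answer L x], [], z, []])
      (callCost B (n + 2 ^ n) (t (n + 2 ^ n))) :=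
    (exec_call (L := [[], [], z, []]) (a := 2) (b := 3) (hB z) (by simp [hans])).mono
      (by simp [hzl])
  exact ((h1.seq (h2.seq h3)).mono (hrb n)).outputsIn (n := 2) (by simp)

theorem classE_eq_of_classP_eq (h : classP = classYP) : classE = classNE ∩ coClass classNE := by
  refine Set.Subset.antisymm (dTime_subset_yTime.trans classYE_subset) fun L hL => ?_
  exact mem_classE_of_padLang (h ▸ padLang_mem_classYP (subset_classYE hL))

/-! ### Covering all inputs by few random strings: `ZPP ⊆ YP`. -/

/-- If every `x` is bad for at most half of the elements of `R`, then fewer than `2 ^ k` elements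
are served by a suitable choice of `k` elements of `R`. -/
theorem exists_cover {α β : Type*} (bad : α → β → Prop) (R : Finset β) (hR : R.Nonempty)
    (S : Set α) [∀ x, DecidablePred (bad x)]
    (h : ∀ x ∈ S, 2 * (R.filter (bad x)).card ≤ R.card) (k : ℕ) (X : Finset α)
    (hXS : ↑X ⊆ S) (hX : X.card < 2 ^ k) :
    ∃ cs : List β, cs.length = k ∧ (∀ c ∈ cs, c ∈ R) ∧ ∀ x ∈ X, ∃ c ∈ cs, ¬ bad x c := by
  classical
  induction k generalizing X with
  | zero =>
    obtain rfl : X = ∅ := Finset.card_eq_zero.mp (by simpa using hX)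
    exact ⟨[], by simp⟩
  | succ k ih =>
    -- Double counting of bad pairs: at most half of `X × R` is bad, so some `r` is bad for at most
    -- half of `X`.
    obtain ⟨r, hr, hr2⟩ : ∃ r ∈ R, 2 * (X.filter (bad · r)).card ≤ X.card := by
      by_contra! hcon
      have h1 : ∑ r ∈ R, X.card < ∑ r ∈ R, 2 * (X.filter (bad · r)).card :=
        Finset.sum_lt_sum_of_nonempty hR hcon
      have h2 : ∑ x ∈ X, 2 * (R.filter (bad x)).card ≤ ∑ x ∈ X, R.card :=
        Finset.sum_le_sum fun x hx => h x (hXS hx)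
      rw [← Finset.mul_sum] at h1 h2
      have h3 : ∑ r ∈ R, (X.filter (bad · r)).card = ∑ x ∈ X, (R.filter (bad x)).card := by
        simp only [Finset.card_filter]
        exact Finset.sum_comm
      simp only [Finset.sum_const, smul_eq_mul] at h1 h2
      rw [h3] at h1
      nlinarith
    obtain ⟨cs, h1, h2, h3⟩ := ih (X.filter (bad · r))
      (fun x hx => hXS (Finset.mem_of_mem_filter x hx)) (by rw [pow_succ] at hX; omega)
    refine ⟨r :: cs, by simp [h1], by simpa [hr] using h2, fun x hx => ?_⟩
    by_cases hb : bad x r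
    · obtain ⟨c, hc, hbc⟩ := h3 x (by simp [hx, hb])
      exact ⟨c, by simp [hc], hbc⟩
    · exact ⟨r, by simp, hb⟩

theorem ncard_words (n : ℕ) : {l : List Bool | l.length = n}.ncard = 2 ^ n := by
  have : Nat.card {l : List Bool // l.length = n} = 2 ^ n := by
    show Nat.card (List.Vector Bool n) = 2 ^ n
    rw [Nat.card_eq_fintype_card, card_vector, Fintype.card_bool]
  rw [← this]
  rfl

theorem finite_words (n : ℕ) : {l : List Bool | l.length = n}.Finite := List.finite_length_eq Bool n

/-- The machine that runs `A` with consecutive parts of the advice as random strings, until it gets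
an answer, but one time more than the input is long. The length of the random strings is computed
by `P`. -/
def repeatProg (A P : Prog) : Prog :=
  .seq (copy 0 2 3) <| .seq (.push 2 true) <|
  .seq (.loop 2 (.seq (.pop 2) (.branch 5 (.seq (ucall P 6 0 3) (.seq (takeBits 3 1 4)
    (.seq (call A 6 0 4 5) (clear 4)))) .skip .skip))) <|
  .seq (clear 0) (move 5 0)

/-- A bound for the number of steps of `repeatProg`. -/
def repeatCost (A : Prog) (p t τ : ℕ → ℕ) (n : ℕ) : ℕ :=
  9 * n + 2 + (1 + ((n + 1) * (1 + (τ n + (5 * p n + 1 + (callCost A (n + p n) (t n) +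
    (2 * p n + 1))) + 1) + 1) + 1 + (2 * n + 1 + 5)))

theorem outputsIn_repeatProg {A : Prog} {p t : ℕ → ℕ} (hP : UComputes P p τ) {x y : List Bool}
    {v : Bool} (hA : ∀ r : List Bool, r.length = p x.length →
      OutputsIn ∅ A x r (t x.length) (some v) ∨ OutputsIn ∅ A x r (t x.length) none) :
    ∃ o, OutputsIn ∅ (repeatProg A P) x y (repeatCost A p t τ x.length) o ∧
      (o = none ∨ o = some v) ∧
      ((∃ cs : List (List Bool), cs.length = x.length + 1 ∧ (∀ c ∈ cs, c.length = p x.length) ∧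
        y = (cs.map List.reverse).flatten ∧
        ∃ c ∈ cs, ¬ OutputsIn ∅ A x c (t x.length) none) → o = some v) := by
  set n := x.length with hn
  -- `G i y` says that `y` consists of `i` reversed random strings, at least one of which makes `A`
  -- answer.
  set G : ℕ → List Bool → Prop := fun i y => ∃ cs : List (List Bool), cs.length = i ∧
    (∀ c ∈ cs, c.length = p n) ∧ y = (cs.map List.reverse).flatten ∧
    ∃ c ∈ cs, ¬ OutputsIn ∅ A x c (t n) none with hG
  have hcopy : Exec ∅ (copy 0 2 3) (st [x, y, [], [], [], []]) (st [x, y, x, [], [], []])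
    (9 * n + 2) := exec_copy (by simp)
  have hpush : Exec ∅ (.push 2 true) (st [x, y, x, [], [], []])
    (st [x, y, true :: x, [], [], []]) 1 := exec_push rfl
  set K := τ n + (5 * p n + 1 + (callCost A (n + p n) (t n) + (2 * p n + 1))) with hK
  -- The invariant: register `5` is empty or holds the answer `v`, and if the advice was good at the
  -- start, then the answer is there or a useful string is still among the remaining ones.
  obtain ⟨s', hs', w, y', o, hw, rfl, ho, hoG⟩ := exec_loop_inv (O := ∅) (r := 2)
    (k := 1 + (K + 1))
    (P := .seq (.pop 2) (.branch 5 (.seq (ucall P 6 0 3) (.seq (takeBits 3 1 4)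
    (.seq (call A 6 0 4 5) (clear 4)))) .skip .skip))
    (fun i s => ∃ (w y' : List Bool) (o : Option Bool), w.length = i ∧
      s = st [x, y', w, [], [], o.toList] ∧ (o = none ∨ o = some v) ∧
      (G (n + 1) y → o = some v ∨ G i y'))
    (by
      rintro s ⟨w, y', o, hw, rfl, -⟩
      exact List.length_eq_zero_iff.mp hw)
    (by
      rintro i s ⟨w, y', o, hw, rfl, ho, hoG⟩
      refine ⟨by rintro h; simp [st] at h; simp [h] at hw, ?_⟩
      have hwt : w.tail.length = i := by simp [hw]
      have hpop : Exec ∅ (.pop 2) (st [x, y', w, [], [], o.toList])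
        (st [x, y', w.tail, [], [], o.toList]) 1 := exec_pop rfl
      rcases ho with rfl | rfl
      · set r := (ptake (p n) y').reverse with hr
        have hrl : r.length = p n := by simp [hr]
        obtain ⟨o, ho, hrun⟩ : ∃ o, (o = none ∨ o = some v) ∧ OutputsIn ∅ A x r (t n) o :=
          (hA r hrl).elim (fun h => ⟨_, .inr rfl, h⟩) fun h => ⟨_, .inl rfl, h⟩
        have h1 : Exec ∅ (ucall P 6 0 3) (st [x, y', w.tail, [], [], []])
          (st [x, y', w.tail, ones (p n), [], []]) (τ n) := exec_ucall hP (by simp [hn])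
        have h2 : Exec ∅ (takeBits 3 1 4) (st [x, y', w.tail, ones (p n), [], []])
          (st [x, y'.drop (p n), w.tail, [], r, []]) (5 * p n + 1) :=
            (exec_takeBits (by simp [hr])).mono (by simp)
        have h3 : Exec ∅ (call A 6 0 4 5) (st [x, y'.drop (p n), w.tail, [], r, []])
          (st [x, y'.drop (p n), w.tail, [], r, o.toList]) (callCost A (n + p n) (t n)) :=
            (exec_call hrun (by simp)).mono (by simp [hrl, hn])
        have h4 : Exec ∅ (clear 4) (st [x, y'.drop (p n), w.tail, [], r, o.toList])
          (st [x, y'.drop (p n), w.tail, [], [], o.toList]) (2 * p n + 1) :=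
            (exec_clear rfl).mono (by simp [hrl])
        refine ⟨_, hpop.seq (exec_branch_st (fun _ => h1.seq (h2.seq (h3.seq h4))) (by simp)
          (by simp)), w.tail, _, o, hwt, rfl, ho, fun hy => ?_⟩
        obtain ⟨cs, hcs, hlen, hflat, c, hc, hcb⟩ := (hoG hy).resolve_left (by simp)
        rcases cs with _ | ⟨c₀, cs⟩
        · simp at hcs
        · have hc₀ : c₀.length = p n := hlen c₀ (by simp)
          have hrc : r = c₀ := by
            have e := ptake_append c₀.reverse (cs.map List.reverse).flatten
            rw [List.length_reverse, hc₀] at e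
            rw [hr, hflat, List.map_cons, List.flatten_cons, e, List.reverse_reverse]
          rcases ho with rfl | rfl
          · refine .inr ⟨cs, by simpa using hcs, fun c hc => hlen c (by simp [hc]), ?_, c, ?_, hcb⟩
            · rw [hflat, List.map_cons, List.flatten_cons, List.drop_left' (by simp [hc₀])]
            · rcases List.mem_cons.mp hc with rfl | hc
              -- The string just used gave "don't know", so it was not the useful one, which
              -- therefore lies in the rest.
              · exact absurd (hrc ▸ hrun) hcb
              · exact hc
          · exact .inl rfl
      · refine ⟨_, hpop.seq (exec_branch_st (by simp) (fun _ _ => exec_skip.mono ?_)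
          (fun _ _ => exec_skip.mono ?_)), w.tail, y', some v, hwt, rfl, .inr rfl,
          fun _ => .inl rfl⟩ <;> omega)
    (n + 1) ⟨true :: x, y, none, by simp [hn], rfl, .inl rfl, fun h => .inr h⟩
  obtain rfl := List.length_eq_zero_iff.mp hw
  have hclear : Exec ∅ (clear 0) (st [x, y', [], [], [], o.toList])
    (st [[], y', [], [], [], o.toList]) (2 * n + 1) := exec_clear rfl
  have hmove : Exec ∅ (move 5 0) (st [[], y', [], [], [], o.toList])
    (st [o.toList, y', [], [], [], []]) 5 :=
      (exec_move (by rcases o with _ | _ <;> simp)).mono (by rcases o with _ | _ <;> simp)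
  refine ⟨o, (hcopy.seq (hpush.seq (hs'.seq (hclear.seq hmove)))).outputsIn (n := 4)
    (by rcases o with _ | _ <;> simp), ho, fun h => (hoG h).resolve_right ?_⟩
  -- At the end no strings remain, so a useful one cannot be among them.
  rintro ⟨cs, hcs, -, -, c, hc, -⟩
  rw [List.length_eq_zero_iff.mp hcs] at hc
  simp at hc

theorem classZPP_subset : classZPP ⊆ classYP := by
  classical
  rintro L ⟨A, p, hp, t, ht, h⟩
  obtain ⟨P, τ, hτ, hP⟩ := uComputable_of_mem_polyBounds hp
  have hT := timeClass_poly
  have hpb := Bdd.of_mem hp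
  have htb := Bdd.of_mem ht
  obtain ⟨r, hr, hrb⟩ : Bdd polyBounds (repeatCost A p t τ) := by
    unfold repeatCost
    repeat' first | assumption | exact hT.const _ | exact hT.id | apply hT.callCost |
      apply hT.add | apply hT.mul
  have hq : (fun n => (n + 1) * p n) ∈ polyBounds := by
    obtain ⟨p', hp'⟩ := hp
    exact ⟨(.X + .C 1) * p', by simp [hp']⟩
  refine ⟨repeatProg A P, _, hq, r, hr, fun n => ⟨?_, ?_⟩⟩
  · have hRc : (finite_words (p n)).toFinset.card = 2 ^ p n := by
      rw [← Set.ncard_eq_toFinset_card _ (finite_words _), ncard_words]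
    -- With `n + 1` strings the cover reaches all `2 ^ n < 2 ^ (n + 1)` inputs.
    obtain ⟨cs, h1, h2, h3⟩ := exists_cover (fun x r => OutputsIn ∅ A x r (t n) none)
      (finite_words (p n)).toFinset (Finset.card_pos.mp (by rw [hRc]; positivity))
      {x | x.length = n} (by
        rintro x rfl
        rw [hRc]
        convert (h x).2
        rw [← Set.ncard_coe_finset]
        congr 1
        ext r
        simp)
      (n + 1) (finite_words n).toFinset (by simp)
      (by rw [← Set.ncard_eq_toFinset_card _ (finite_words _), ncard_words]; exact Nat.pow_lt_pow_right (by norm_num) (by omega))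
    simp only [Set.Finite.mem_toFinset, Set.mem_ofPred_eq] at h2 h3
    refine ⟨(cs.map List.reverse).flatten, ?_, ?_⟩
    · rw [List.length_flatten, List.map_map, List.eq_replicate_of_mem (a := p n)
        (l := cs.map (List.length ∘ List.reverse)) (by simpa using h2)]
      simp [h1]
    · rintro x rfl
      obtain ⟨o, ho, -, hgood⟩ := outputsIn_repeatProg (y := (cs.map List.reverse).flatten) hP
        (h x).1
      rw [hgood ⟨cs, h1, h2, rfl, h3 x rfl⟩] at ho
      exact ho.mono (hrb _)
  · rintro x y rfl
    obtain ⟨o, ho, rfl | rfl, -⟩ := outputsIn_repeatProg (y := y) hP (h x).1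
    · exact .inr (ho.mono (hrb _))
    · exact .inl (ho.mono (hrb _))

/-! ### Reliable advice: unreliability in `NP`, extendability in `NP` with that oracle. -/

theorem monotone_of_mem_polyBounds (hf : f ∈ polyBounds) : Monotone f := by
  obtain ⟨p, hp⟩ := hf
  obtain rfl : f = fun n => p.eval n := funext hp
  exact monotone_eval p

theorem exists_uComputes (hf : f ∈ polyBounds) : ∃ P, ∃ τ ∈ polyBounds, UComputes P f τ := by
  obtain ⟨P, τ, ⟨t, ht, hle⟩, h⟩ := uComputable_of_mem_polyBounds hf
  exact ⟨P, t, ht, fun O x u => (h O x u).mono (hle _)⟩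

theorem callCost_mono {P : Prog} {N N' k k' : ℕ} (h : N ≤ N') (h' : k ≤ k') :
    callCost P N k ≤ callCost P N' k' := by
  unfold callCost
  gcongr

/-- The number `n` in a word `true ^ n false u`. -/
def header : List Bool → ℕ
  | true :: z => header z + 1
  | _ => 0

/-- The word `u` in a word `true ^ n false u`. -/
def body : List Bool → List Bool
  | true :: z => body z
  | false :: z => z
  | [] => []

/-- The word `true ^ n false u`. -/
def withHeader (n : ℕ) (u : List Bool) : List Bool := ones n ++ false :: u

@[simp] theorem header_withHeader (n : ℕ) (u : List Bool) : header (withHeader n u) = n := by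
  induction n with
  | zero => rfl
  | succ n ih => exact congrArg (· + 1) ih

@[simp] theorem body_withHeader (n : ℕ) (u : List Bool) : body (withHeader n u) = u := by
  induction n with
  | zero => rfl
  | succ n ih => exact ih

/-- The number in the header is written in unary, so bounds polynomial in it are polynomial in the
length of the word. -/
theorem header_le (z : List Bool) : header z ≤ z.length := by
  induction z with
  | nil => simp [header]
  | cons b z ih => cases b <;> simp [header, ih]

theorem length_body_le (z : List Bool) : (body z).length ≤ z.length := by
  induction z with
  | nil => simp [body]
  | cons b z ih => cases b <;> simp [body]; omega

/-- Move the header of the word in register `0` to register `3`. -/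
def splitHeader : Prog :=
  .seq (.push 2 true) (.loop 2 (.branch 0 (.pop 2) (.seq (.pop 0) (.pop 2))
    (.seq (.pop 0) (.push 3 true))))

theorem exec_splitHeader (z w : List Bool) (R : List (List Bool)) :
    Exec O splitHeader (st (z :: w :: [] :: [] :: R))
      (st (body z :: w :: [] :: ones (header z) :: R)) (4 * z.length + 6) := by
  have key : ∀ (z : List Bool) (n : ℕ),
      Exec O (.loop 2 (.branch 0 (.pop 2) (.seq (.pop 0) (.pop 2)) (.seq (.pop 0) (.push 3 true))))
        (st (z :: w :: [true] :: ones n :: R))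
        (st (body z :: w :: [] :: ones (n + header z) :: R)) (4 * z.length + 5) := by
    intro z
    induction z with
    | nil =>
      intro n
      refine (exec_loop_step (by simp [st]) (exec_branch_st (M := [] :: w :: [] :: ones n :: R)
        (fun _ => exec_pop rfl) (by simp) (by simp)) (exec_loop_done rfl)).mono (by simp)
    | cons b z ih =>
      intro n
      cases b
      · refine (exec_loop_step (by simp [st]) (exec_branch_st (M := z :: w :: [] :: ones n :: R)
          (by simp) (fun _ _ => (exec_pop rfl).seq (exec_pop rfl)) (by simp))
          (exec_loop_done rfl)).mono (by simp)
      · have h := ih (n + 1)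
        rw [show n + 1 + header z = n + header (true :: z) by simp [header]; omega] at h
        refine (exec_loop_step (by simp [st]) (exec_branch_st
          (M := z :: w :: [true] :: ones (n + 1) :: R) (by simp) (by simp)
          (fun _ _ => (exec_pop rfl).seq (exec_push rfl))) h).mono (by simp; omega)
  have h := (exec_push (O := O) (r := 2) (v := true) (L := z :: w :: [] :: [] :: R) rfl).seq
    (key z 0)
  rw [zero_add] at h
  exact h.mono (by omega)

section Advice

variable (A : Prog) (p t : ℕ → ℕ)

/-- The advice `y` makes `A` answer on all inputs of length `n`. -/
def Reliable (n : ℕ) (y : List Bool) : Prop :=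
  ∀ x : List Bool, x.length = n → ¬ OutputsIn ∅ A x y (t n) none

/-- The words `true ^ n false y` such that the advice `y` is not reliable for the length `n`. -/
def unreliableLang : Set (List Bool) := {z | ¬ Reliable A t (header z) (body z)}

/-- The words `true ^ n false u` such that `u` is the end of a reliable advice of length `p n`. -/
def extendableLang : Set (List Bool) :=
  {z | ∃ w : List Bool, w.length = p (header z) - (body z).length ∧
    Reliable A t (header z) (w ++ body z)}

/-- The verifier for `unreliableLang`, which guesses an input on which `A` does not answer. -/
def unreliableProg : Prog :=
  .seq splitHeader <| .seq (takeBits 3 1 4) <| .seq (call A 6 4 0 5) <| .seq (clear 0) <|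
  .branch 5 (.push 0 true) .skip .skip

/-- A bound for the number of steps of `unreliableProg`. -/
def unreliableCost (m : ℕ) : ℕ :=
  4 * m + 6 + (5 * m + 1 + (callCost A (m + m) (t m) + (2 * m + 1 + 2)))

variable {A p t}

theorem outputsIn_unreliableProg (ht : Monotone t) {z w x : List Bool}
    (hx : x = (ptake (header z) w).reverse) {o : Option Bool}
    (ho : OutputsIn ∅ A x (body z) (t (header z)) o) :
    OutputsIn ∅ (unreliableProg A) z w (unreliableCost A t z.length)
      (if o = none then some true else none) := by
  have hn := header_le z
  have hb := length_body_le z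
  set n := header z
  set y := body z
  set m := z.length
  have hxl : x.length = n := by simp [hx]
  have h1 := exec_splitHeader (O := ∅) z w [[], []]
  have h2 : Exec ∅ (takeBits 3 1 4) (st [y, w, [], ones n, [], []])
    (st [y, w.drop n, [], [], x, []]) (5 * m + 1) :=
      (exec_takeBits (by simp [hx])).mono (by simp [hn])
  have h3 : Exec ∅ (call A 6 4 0 5) (st [y, w.drop n, [], [], x, []])
    (st [y, w.drop n, [], [], x, o.toList]) (callCost A (m + m) (t m)) :=
      (exec_call ho (by simp)).mono (callCost_mono (by simp [hxl]; omega) (ht hn))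
  have h4 : Exec ∅ (clear 0) (st [y, w.drop n, [], [], x, o.toList])
    (st [[], w.drop n, [], [], x, o.toList]) (2 * m + 1) := (exec_clear rfl).mono (by simp [hb])
  have h5 : Exec ∅ (.branch 5 (.push 0 true) .skip .skip)
      (st [[], w.drop n, [], [], x, o.toList])
      (st [(if o = none then some true else none).toList, w.drop n, [], [], x, o.toList])
      (1 + 1) := by
    rcases o with _ | o
    · exact exec_branch_st (fun _ => exec_push rfl) (by simp) (by simp)
    · exact exec_branch_st (by simp) (fun _ _ => exec_skip) (fun _ _ => exec_skip)
  exact (h1.seq (h2.seq (h3.seq (h4.seq h5)))).outputsIn (n := 4) (by split_ifs <;> simp)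

theorem unreliableLang_mem_classNP (ht : t ∈ polyBounds)
    (hA : ∀ x y : List Bool, ∃ o, OutputsIn ∅ A x y (t x.length) o) :
    unreliableLang A t ∈ classNP := by
  have hT := timeClass_poly
  have htb := Bdd.of_mem ht
  have htm := monotone_of_mem_polyBounds ht
  obtain ⟨r, hr, hrb⟩ : Bdd polyBounds (unreliableCost A t) := by
    unfold unreliableCost
    repeat' first | assumption | exact hT.const _ | exact hT.id | apply hT.callCost |
      apply hT.add | apply hT.mul
  have run : ∀ z w : List Bool, ∃ o,
      OutputsIn ∅ A (ptake (header z) w).reverse (body z) (t (header z)) o ∧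
      OutputsIn ∅ (unreliableProg A) z w (r z.length) (if o = none then some true else none) := by
    intro z w
    obtain ⟨o, ho⟩ := hA (ptake (header z) w).reverse (body z)
    rw [List.length_reverse, length_ptake] at ho
    exact ⟨o, ho, (outputsIn_unreliableProg htm rfl ho).mono (hrb _)⟩
  -- A bad input has length `header z ≤ z.length`, so a guess of length `z.length` suffices; surplus
  -- bits are ignored.
  refine ⟨unreliableProg A, fun n => n, ⟨.X, by simp⟩, r, hr, fun z w _ => ?_, fun z => ⟨?_, ?_⟩⟩
  · obtain ⟨o, -, h⟩ := run z w
    exact ⟨_, h⟩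
  · intro hz
    simp only [unreliableLang, Reliable, Set.mem_ofPred_eq, not_forall, not_not] at hz
    obtain ⟨x, hx, hxo⟩ := hz
    have hle := header_le z
    refine ⟨x.reverse ++ List.replicate (z.length - header z) true, by simp [hx]; omega, ?_⟩
    obtain ⟨o, ho, h⟩ := run z (x.reverse ++ List.replicate (z.length - header z) true)
    have e := ptake_append x.reverse (List.replicate (z.length - header z) true)
    rw [List.length_reverse, hx] at e
    rw [e, List.reverse_reverse] at ho
    rw [ho.det hxo] at h
    exact h
  · rintro ⟨w, -, hw⟩ hrel
    obtain ⟨o, ho, h⟩ := run z w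
    have := h.det hw
    split_ifs at this with h0
    · subst h0
      exact hrel _ (by simp) ho

/-- The verifier for `extendableLang`, which guesses the rest of the advice. The advice length is
computed by `P`. -/
def extendableProg (P : Prog) : Prog :=
  .seq splitHeader <| .seq (ucall P 8 3 4) <| .seq (copy 0 5 7) <|
  .seq (.loop 5 (.seq (.pop 5) (.pop 4))) <| .seq (takeBits 4 1 0) <| .seq (.push 0 false) <|
  .seq (move 3 0) <| .seq (.query 0 6) <| .seq (clear 0) <|
  .branch 6 .skip (.push 0 true) .skip

/-- A bound for the number of steps of `extendableProg`. -/
def extendableCost (p τ : ℕ → ℕ) (m : ℕ) : ℕ :=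
  4 * m + 6 + (τ m + (9 * m + 2 + (3 * m + 1 + (5 * p m + 1 + (1 + (4 * m + 1 + (1 +
  (2 * (m + p m + m + 1) + 1 + 2))))))))

/-- Popping an empty register has no effect, which agrees with truncated subtraction. -/
theorem exec_subtract {a b c d e g : List Bool} (u : List Bool) (n : ℕ) :
    Exec O (.loop 5 (.seq (.pop 5) (.pop 4))) (st [a, b, c, d, ones n, u, e, g])
      (st [a, b, c, d, ones (n - u.length), [], e, g]) (3 * u.length + 1) := by
  induction u generalizing n with
  | nil => exact exec_loop_done rfl
  | cons v u ih =>
    have h := ih (n - 1)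
    rw [show n - 1 - u.length = n - (v :: u).length by simp; omega] at h
    exact (exec_loop_step (by simp [st]) ((exec_pop rfl).seq (exec_pop (by simp))) h).mono
      (by simp; omega)

-- The guess completes the suffix to a full advice string, and one oracle question decides
-- reliability. The oracle recognises unreliable strings, so acceptance goes with the answer
-- `false`.
open Classical in
theorem outputsIn_extendableProg (hp : Monotone p) (hτ : Monotone τ) (hP : UComputes P p τ)
    (z w : List Bool) :
    OutputsIn (unreliableLang A t) (extendableProg P) z w (extendableCost p τ z.length)
      (if Reliable A t (header z)
        ((ptake (p (header z) - (body z).length) w).reverse ++ body z) then some true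
        else none) := by
  have hn := header_le z
  have hb := length_body_le z
  set n := header z
  set u := body z
  set m := z.length
  set O := unreliableLang A t
  have hpn := hp hn
  set k := p n - u.length with hk
  set v := (ptake k w).reverse with hv
  have hvl : v.length = k := by simp [hv]
  have h1 := exec_splitHeader (O := O) z w [[], [], [], []]
  have h2 : Exec O (ucall P 8 3 4) (st [u, w, [], ones n, [], [], [], []])
    (st [u, w, [], ones n, ones (p n), [], [], []]) (τ m) :=
      (exec_ucall hP (by simp)).mono (by simpa using hτ hn)
  have h3 : Exec O (copy 0 5 7) (st [u, w, [], ones n, ones (p n), [], [], []])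
    (st [u, w, [], ones n, ones (p n), u, [], []]) (9 * m + 2) :=
      (exec_copy (by simp)).mono (by simp; omega)
  have h4 : Exec O (.loop 5 (.seq (.pop 5) (.pop 4)))
    (st [u, w, [], ones n, ones (p n), u, [], []])
    (st [u, w, [], ones n, ones k, [], [], []]) (3 * m + 1) :=
      (exec_subtract u (p n)).mono (by omega)
  have h5 : Exec O (takeBits 4 1 0) (st [u, w, [], ones n, ones k, [], [], []])
    (st [v ++ u, w.drop k, [], ones n, [], [], [], []]) (5 * p m + 1) :=
      (exec_takeBits (by simp [hv])).mono (by simp; omega)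
  have h6 : Exec O (.push 0 false) (st [v ++ u, w.drop k, [], ones n, [], [], [], []])
    (st [false :: (v ++ u), w.drop k, [], ones n, [], [], [], []]) 1 := exec_push rfl
  set q := withHeader n (v ++ u) with hq
  have h7 : Exec O (move 3 0) (st [false :: (v ++ u), w.drop k, [], ones n, [], [], [], []])
    (st [q, w.drop k, [], [], [], [], [], []]) (4 * m + 1) :=
      (exec_move (by simp [hq, withHeader])).mono (by simp; omega)
  have h8 : Exec O (.query 0 6) (st [q, w.drop k, [], [], [], [], [], []])
    (st [q, w.drop k, [], [], [], [], [decide (q ∈ O)], []]) 1 := exec_query rfl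
  have h9 : Exec O (clear 0) (st [q, w.drop k, [], [], [], [], [decide (q ∈ O)], []])
    (st [[], w.drop k, [], [], [], [], [decide (q ∈ O)], []]) (2 * (m + p m + m + 1) + 1) :=
      (exec_clear rfl).mono (by simp [hq, withHeader, hvl]; omega)
  have hqO : q ∈ O ↔ ¬ Reliable A t n (v ++ u) := by
    simp [O, unreliableLang, hq]
  have h10 : Exec O (.branch 6 .skip (.push 0 true) .skip)
      (st [[], w.drop k, [], [], [], [], [decide (q ∈ O)], []])
      (st [(if Reliable A t n (v ++ u) then some true else none).toList, w.drop k, [], [], [], [],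
        [decide (q ∈ O)], []]) (1 + 1) := by
    by_cases hrel : Reliable A t n (v ++ u)
    · have : q ∉ O := fun h => hqO.mp h hrel
      refine exec_branch_st (by simp) (fun _ _ => exec_push ?_) (by simp [this])
      simp [hrel]
    · have : q ∈ O := hqO.mpr hrel
      refine exec_branch_st (by simp) (by simp [this]) (fun _ _ => ?_)
      simpa [hrel] using exec_skip
  exact (h1.seq (h2.seq (h3.seq (h4.seq (h5.seq (h6.seq (h7.seq (h8.seq
    (h9.seq h10))))))))).outputsIn (n := 6) (by split_ifs <;> simp)

theorem extendableLang_mem_nTimeOracle (hp : p ∈ polyBounds) :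
    extendableLang A p t ∈ NTimeOracle polyBounds (unreliableLang A t) := by
  classical
  have hT := timeClass_poly
  obtain ⟨P, τ, hτ, hP⟩ := exists_uComputes hp
  have hpm := monotone_of_mem_polyBounds hp
  have hτm := monotone_of_mem_polyBounds hτ
  have hpb := Bdd.of_mem hp
  have hτb := Bdd.of_mem hτ
  obtain ⟨r, hr, hrb⟩ : Bdd polyBounds (extendableCost p τ) := by
    unfold extendableCost
    repeat' first | assumption | exact hT.const _ | exact hT.id | apply hT.add | apply hT.mul
  have run := fun z w => (outputsIn_extendableProg (A := A) (t := t) hpm hτm hP z w).mono (hrb _)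
  refine ⟨extendableProg P, p, hp, r, hr, fun z w _ => ⟨_, run z w⟩, fun z => ⟨?_, ?_⟩⟩
  · rintro ⟨w, hw, hrel⟩
    have hle : w.length ≤ p z.length := by
      rw [hw]
      exact (Nat.sub_le _ _).trans (hpm (header_le z))
    refine ⟨w.reverse ++ List.replicate (p z.length - w.length) true, by simp; omega, ?_⟩
    have h := run z (w.reverse ++ List.replicate (p z.length - w.length) true)
    have e := ptake_append w.reverse (List.replicate (p z.length - w.length) true)
    rw [List.length_reverse] at e
    rwa [← hw, e, List.reverse_reverse, if_pos hrel] at h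
  · rintro ⟨w, -, hw⟩
    have h := (run z w).det hw
    split_ifs at h with hrel
    exact ⟨_, by simp, hrel⟩

end Advice

/-! ### Searching for reliable advice, with the length and the position given in binary. -/

/-- The two numbers whose binary digits alternate in a word, continuing the digits of `a`
and `b`. -/
def unzipBin : List Bool → ℕ → ℕ → ℕ × ℕ
  | [], a, b => (a, b)
  | v :: z, a, b => unzipBin z.tail (2 * a + v.toNat) (2 * b + (z.headD false).toNat)
termination_by z => z.length
decreasing_by simp

/-- The word in which the binary digits of `a` and `b` alternate, as many as `m` has, before the
word `acc`. -/
def zipBin (m a b : ℕ) (acc : List Bool) : List Bool :=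
  if m = 0 then acc
  else zipBin (m / 2) (a / 2) (b / 2) (decide (a % 2 = 1) :: decide (b % 2 = 1) :: acc)
termination_by m

theorem two_mul_half_add_bit (a : ℕ) : 2 * (a / 2) + (decide (a % 2 = 1)).toNat = a := by
  rcases Nat.mod_two_eq_zero_or_one a with h | h <;> simp [h] <;> omega

/-- Halving `m` keeps it above both numbers, so when it reaches `0` all their digits have been
written. Digits already in `acc` are read last. -/
theorem unzipBin_zipBin (m a b : ℕ) (ha : a ≤ m) (hb : b ≤ m) (acc : List Bool) :
    unzipBin (zipBin m a b acc) 0 0 = unzipBin acc a b := by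
  induction m using Nat.strong_induction_on generalizing a b acc with
  | _ m ih =>
    rw [zipBin]
    split_ifs with hm
    · obtain rfl : a = 0 := by omega
      obtain rfl : b = 0 := by omega
      rfl
    · rw [ih (m / 2) (by omega) _ _ (by omega) (by omega), unzipBin]
      simp only [List.tail_cons, List.headD_cons, two_mul_half_add_bit]

/-- Each halving of `m` adds two digits, so the length is about `2 * log m`. This is what makes time
exponential in the length of the code polynomial in the coded numbers. -/
theorem two_pow_length_zipBin (m a b : ℕ) (hm : 0 < m) (acc : List Bool) :
    2 ^ (zipBin m a b acc).length ≤ (2 * m) ^ 2 * 2 ^ acc.length := by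
  induction m using Nat.strong_induction_on generalizing a b acc with
  | _ m ih =>
    rw [zipBin, if_neg hm.ne']
    rcases Nat.eq_zero_or_pos (m / 2) with h | h
    · rw [h, zipBin, if_pos rfl, List.length_cons, List.length_cons, pow_succ, pow_succ, mul_assoc,
        mul_comm]
      gcongr
      nlinarith
    · refine (ih _ (by omega) _ _ h _).trans ?_
      have : 2 * (m / 2) ≤ m := by omega
      calc (2 * (m / 2)) ^ 2 * 2 ^ (acc.length + 1 + 1)
          = (2 * (2 * (m / 2))) ^ 2 * 2 ^ acc.length := by ring
        _ ≤ (2 * m) ^ 2 * 2 ^ acc.length := by gcongr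

/-- Replace the word in register `0` by the numbers that it stands for, in the registers `2`
and `3`. -/
def unzipProg : Prog := .loop 0 (.seq (shiftBit 0 2 7) (shiftBit 0 3 7))

/-- The hypotheses bound what the numbers can become with the digits still to be read; they persist
because reading a digit at most doubles `a + 1`. -/
theorem exec_unzipProg {w : List Bool} (N : ℕ) (z : List Bool) (a b : ℕ)
    (ha : (a + 1) * 2 ^ z.length ≤ N) (hb : (b + 1) * 2 ^ z.length ≤ N) :
    Exec O unzipProg (st [z, w, ones a, ones b, [], [], [], []])
      (st [[], w, ones (unzipBin z a b).1, ones (unzipBin z a b).2, [], [], [], []])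
      (z.length * (24 * N + 11) + 1) ∧ (unzipBin z a b).1 ≤ N ∧ (unzipBin z a b).2 ≤ N := by
  induction hl : z.length using Nat.strong_induction_on generalizing z a b with
  | _ l ih =>
    subst hl
    rcases z with _ | ⟨v, z⟩
    · rw [unzipBin]
      simp only [List.length_nil, pow_zero, mul_one] at ha hb
      exact ⟨(exec_loop_done rfl).mono (by simp), by omega, by omega⟩
    · rw [unzipBin]
      rw [List.length_cons, pow_succ, mul_comm _ 2, ← mul_assoc] at ha hb
      have hpos : 0 < 2 ^ z.length := by positivity
      have hpow : 2 ^ z.tail.length ≤ 2 ^ z.length :=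
        Nat.pow_le_pow_right (by norm_num) (by simp)
      have hbit : ∀ (c : ℕ) (e : Bool), (c + 1) * 2 * 2 ^ z.length ≤ N →
          (2 * c + e.toNat + 1) * 2 ^ z.tail.length ≤ N := by
        intro c e hc
        refine le_trans ?_ hc
        gcongr
        cases e <;> simp <;> omega
      obtain ⟨h1, h2, h3⟩ := ih _ (by simp) z.tail _ _ (hbit a v ha)
        (hbit b (z.headD false) hb) rfl
      refine ⟨?_, h2, h3⟩
      have hs1 : Exec O (shiftBit 0 2 7) (st [v :: z, w, ones a, ones b, [], [], [], []])
        (st [z, w, ones (2 * a + v.toNat), ones b, [], [], [], []]) (12 * N + 5) :=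
          (exec_shiftBit (by simp)).mono (by simp; nlinarith)
      have hs2 : Exec O (shiftBit 0 3 7)
        (st [z, w, ones (2 * a + v.toNat), ones b, [], [], [], []])
        (st [z.tail, w, ones (2 * a + v.toNat), ones (2 * b + (z.headD false).toNat), [], [], [],
          []]) (12 * N + 5) := (exec_shiftBit (by simp)).mono (by simp; nlinarith)
      refine (exec_loop_step (by simp [st]) (hs1.seq hs2) h1).mono ?_
      have : z.tail.length * (24 * N + 11) ≤ z.length * (24 * N + 11) := by
        gcongr
        simp
      rw [List.length_cons, add_mul]
      omega

open Classical in
/-- The word whose bits are found one by one, from the end, with questions to `O` whether the bit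
`true` is possible. -/
noncomputable def searchWord (O : Set (List Bool)) (n : ℕ) : ℕ → List Bool
  | 0 => []
  | k + 1 => decide (withHeader n (true :: searchWord O n k) ∈ O) :: searchWord O n k

@[simp] theorem length_searchWord (n k : ℕ) : (searchWord O n k).length = k := by
  induction k with
  | zero => rfl
  | succ k ih => simp [searchWord, ih]

theorem reliable_searchWord {A : Prog} {p t : ℕ → ℕ} {n : ℕ}
    (h : ∃ y : List Bool, y.length = p n ∧ Reliable A t n y) :
    Reliable A t n (searchWord (extendableLang A p t) n (p n)) := by
  classical
  -- The invariant of the search: the suffix found so far can be completed to a reliable string of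
  -- length `p n`.
  have key : ∀ k ≤ p n, ∃ w : List Bool, w.length = p n - k ∧
      Reliable A t n (w ++ searchWord (extendableLang A p t) n k) := by
    intro k
    induction k with
    | zero => exact fun _ => by simpa [searchWord] using h
    | succ k ih =>
      intro hk
      obtain ⟨w, hw, hrel⟩ := ih (by omega)
      set u := searchWord (extendableLang A p t) n k with hu
      by_cases hmem : withHeader n (true :: u) ∈ extendableLang A p t
      · obtain ⟨w', hw', hrel'⟩ := id hmem
        simp only [header_withHeader, body_withHeader, List.length_cons, hu,
          length_searchWord] at hw' hrel'
        refine ⟨w', hw', ?_⟩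
        rw [searchWord, ← hu, decide_eq_true hmem]
        exact hrel'
      -- The oracle rules out `true`. The current suffix is extendable, so the bit next to it in any
      -- completion must be `false`.
      · have hne : w ≠ [] := by rintro rfl; simp at hw; omega
        obtain ⟨w', b, rfl⟩ : ∃ w' b, w = w' ++ [b] := ⟨_, _, (List.dropLast_append_getLast hne).symm⟩
        simp only [List.length_append, List.length_singleton] at hw
        rw [List.append_assoc, List.singleton_append] at hrel
        refine ⟨w', by omega, ?_⟩
        rw [searchWord, ← hu, decide_eq_false hmem]
        cases b
        · exact hrel
        · refine absurd ⟨w', ?_, by simpa using hrel⟩ hmem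
          simp [hu]
          omega
  obtain ⟨w, hw, hrel⟩ := key _ le_rfl
  obtain rfl : w = [] := List.length_eq_zero_iff.mp (by omega)
  exact hrel

/-- The words that stand for numbers `n` and `k` such that the `k`-th bit of `searchWord`
is `true`. -/
def searchLang (O : Set (List Bool)) : Set (List Bool) :=
  {z | (searchWord O (unzipBin z 0 0).1 (unzipBin z 0 0).2).head? = some true}

/-- The machine with oracle `O` for `searchLang O`. -/
def searchProg : Prog :=
  .seq unzipProg <| .seq
  (.loop 3 <| .seq (.pop 3) <| .seq (.push 4 true) <| .seq (copy 4 5 7) <| .seq (.push 5 false) <|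
    .seq (copy 2 5 7) <| .seq (.query 5 6) <| .seq (clear 5) <|
    .seq (.branch 6 .skip (.seq (.pop 4) (.push 4 false)) .skip) (.pop 6)) <|
  .branch 4 .skip .skip (.push 0 true)

/-- A bound for the number of steps of `searchProg`. -/
def searchCost (m : ℕ) : ℕ :=
  m * (24 * 2 ^ m + 11) + 1 + (2 ^ m * (1 + (1 + (9 * (2 ^ m + 1) + 2 + (1 + (9 * 2 ^ m + 2 + (1 +
    (2 * (2 ^ m + 2 ^ m + 2) + 1 + (3 + 1))))))) + 1) + 1 + 2)

-- Both coded numbers are at most `2 ^ |z|`, so the search and its unary queries stay within `2 ^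
-- O(|z|)`. Each pass tentatively puts `true` in front of the suffix and replaces it if the oracle
-- objects.
open Classical in
theorem outputsIn_searchProg (z w : List Bool) :
    OutputsIn O searchProg z w (searchCost z.length)
      (if z ∈ searchLang O then some true else none) := by
  obtain ⟨h1, hn, hk⟩ := exec_unzipProg (O := O) (w := w) (2 ^ z.length) z 0 0 (by simp) (by simp)
  set n := (unzipBin z 0 0).1 with hn_def
  set k := (unzipBin z 0 0).2 with hk_def
  set N := 2 ^ z.length
  set body : Prog := .seq (.pop 3) <| .seq (.push 4 true) <| .seq (copy 4 5 7) <|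
    .seq (.push 5 false) <| .seq (copy 2 5 7) <| .seq (.query 5 6) <| .seq (clear 5) <|
    .seq (.branch 6 .skip (.seq (.pop 4) (.push 4 false)) .skip) (.pop 6) with hbody
  have h2 := exec_loop_seq (O := O) (P := body) (r := 3) (n := k)
    (k := 1 + (1 + (9 * (N + 1) + 2 + (1 + (9 * N + 2 + (1 +
    (2 * (N + N + 2) + 1 + (3 + 1))))))))
    (fun i => st [[], w, ones n, ones i, searchWord O n (k - i), [], [], []]) (by simp [st])
    (fun i hi => by
      refine ⟨by simp [st], ?_⟩
      rw [show k - i = k - (i + 1) + 1 by omega, searchWord]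
      have hul : (searchWord O n (k - (i + 1))).length = k - (i + 1) := length_searchWord _ _
      set u := searchWord O n (k - (i + 1))
      have g1 : Exec O (.pop 3) (st [[], w, ones n, ones (i + 1), u, [], [], []])
        (st [[], w, ones n, ones i, u, [], [], []]) 1 := exec_pop rfl
      have g2 : Exec O (.push 4 true) (st [[], w, ones n, ones i, u, [], [], []])
        (st [[], w, ones n, ones i, true :: u, [], [], []]) 1 := exec_push rfl
      have g3 : Exec O (copy 4 5 7) (st [[], w, ones n, ones i, true :: u, [], [], []])
        (st [[], w, ones n, ones i, true :: u, true :: u, [], []]) (9 * (N + 1) + 2) :=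
          (exec_copy (by simp)).mono (by simp; omega)
      have g4 : Exec O (.push 5 false) (st [[], w, ones n, ones i, true :: u, true :: u, [], []])
        (st [[], w, ones n, ones i, true :: u, false :: true :: u, [], []]) 1 := exec_push rfl
      set q := withHeader n (true :: u) with hq
      have g5 : Exec O (copy 2 5 7)
        (st [[], w, ones n, ones i, true :: u, false :: true :: u, [], []])
        (st [[], w, ones n, ones i, true :: u, q, [], []]) (9 * N + 2) :=
          (exec_copy rfl).mono (by simp; omega)
      have g6 : Exec O (.query 5 6) (st [[], w, ones n, ones i, true :: u, q, [], []])
        (st [[], w, ones n, ones i, true :: u, q, [decide (q ∈ O)], []]) 1 := exec_query rfl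
      have g7 : Exec O (clear 5)
        (st [[], w, ones n, ones i, true :: u, q, [decide (q ∈ O)], []])
        (st [[], w, ones n, ones i, true :: u, [], [decide (q ∈ O)], []])
        (2 * (N + N + 2) + 1) :=
          (exec_clear rfl).mono (by simp [hq, withHeader]; omega)
      have g8 : Exec O (.branch 6 .skip (.seq (.pop 4) (.push 4 false)) .skip)
        (st [[], w, ones n, ones i, true :: u, [], [decide (q ∈ O)], []])
        (st [[], w, ones n, ones i, decide (q ∈ O) :: u, [], [decide (q ∈ O)], []]) (2 + 1) := by
        by_cases hqO : q ∈ O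
        · rw [decide_eq_true hqO]
          exact exec_branch_st (by simp) (by simp) (fun _ _ => exec_skip.mono (by omega))
        · rw [decide_eq_false hqO]
          exact exec_branch_st (by simp) (fun _ _ => (exec_pop rfl).seq (exec_push rfl)) (by simp)
      have g9 : Exec O (.pop 6)
        (st [[], w, ones n, ones i, decide (q ∈ O) :: u, [], [decide (q ∈ O)], []])
        (st [[], w, ones n, ones i, decide (q ∈ O) :: u, [], [], []]) 1 := exec_pop rfl
      exact g1.seq (g2.seq (g3.seq (g4.seq (g5.seq (g6.seq (g7.seq (g8.seq g9))))))))
  rw [Nat.sub_self, Nat.sub_zero] at h2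
  have h2' := h2.mono (l := N * (1 + (1 + (9 * (N + 1) + 2 + (1 + (9 * N + 2 + (1 +
    (2 * (N + N + 2) + 1 + (3 + 1))))))) + 1) + 1) (by gcongr)
  have hz : z ∈ searchLang O ↔ (searchWord O n k).head? = some true := Iff.rfl
  have h3 : Exec O (.branch 4 .skip .skip (.push 0 true))
      (st [[], w, ones n, [], searchWord O n k, [], [], []])
      (st [(if z ∈ searchLang O then some true else none).toList, w, ones n, [], searchWord O n k,
        [], [], []]) (1 + 1) := by
    simp only [hz]
    refine exec_branch_st (fun h => ?_) (fun u h => ?_) (fun u h => ?_)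
    · simp at h
      simpa [h] using exec_skip
    · simp at h
      simpa [h] using exec_skip
    · simp at h
      exact exec_push (by simp [h])
  exact (h1.seq (h2'.seq h3)).outputsIn (n := 6) (by split_ifs <;> simp)

theorem searchLang_mem_nTimeOracle (O : Set (List Bool)) :
    searchLang O ∈ NTimeOracle expBounds O := by
  classical
  have hT := timeClass_exp
  have h2 : Bdd expBounds fun n => 2 ^ n := .of_mem ⟨1, 0, by simp⟩
  obtain ⟨r, hr, hrb⟩ : Bdd expBounds searchCost := by
    unfold searchCost
    repeat' first | assumption | exact hT.const _ | exact hT.id | apply hT.add | apply hT.mul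
  have run := fun z w => (outputsIn_searchProg (O := O) z w).mono (hrb _)
  -- The search is deterministic: the guess is filler, and its length is just a bound at hand.
  refine ⟨searchProg, r, hr, r, hr, fun z w _ => ⟨_, run z w⟩, fun z => ⟨fun hz => ?_, ?_⟩⟩
  · refine ⟨List.replicate (r z.length) true, by simp, ?_⟩
    simpa [hz] using run z (List.replicate (r z.length) true)
  · rintro ⟨w, -, hw⟩
    have h := (run z w).det hw
    split_ifs at h with hz
    exact hz

/-! ### Assembling the advice in polynomial time. -/

/-- The part of `assembleProg` that finds one bit of the advice with the machine `M`. -/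
def assembleStep (M : Prog) : Prog :=
  .seq (.pop 2) <| .seq (.push 3 true) <| .seq (copy 0 6 10) <| .seq (copy 3 7 10) <|
  .seq (copy 0 8 10) <| .seq (copy 3 8 10) <|
  .seq (.loop 8 (.seq (halve 7 10 5) (.seq (halve 6 10 5) (.seq (halve 8 10 11) (.pop 11))))) <|
  .seq (call M 12 5 1 9) <| .seq (move 9 4) (clear 5)

/-- The machine that finds the advice bit by bit with the machine `M` for `searchLang`, and then
runs `A`. The advice length is computed by `P`. -/
def assembleProg (A M P : Prog) : Prog :=
  .seq (ucall P 12 0 2) <| .seq (.loop 2 (assembleStep M)) <|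
  .seq (call A 12 0 4 11) <| .seq (clear 0) (move 11 0)

/-- The length of register `8` plays the part of the argument `m` of `zipBin`. Register `7` is
halved before register `6`, so the digit of the first number ends up in front of that of the second.
-/
theorem exec_zipLoop {x x2 x3 x4 : List Bool} {N : ℕ} (m : ℕ) (hm : m ≤ N) (a b c acc : List Bool)
    (ha : a.length ≤ m) (hb : b.length ≤ m) (hc : c.length = m) :
    Exec O (.loop 8 (.seq (halve 7 10 5) (.seq (halve 6 10 5) (.seq (halve 8 10 11) (.pop 11)))))
      (st [x, [], x2, x3, x4, acc, a, b, c, [], [], []])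
      (st [x, [], x2, x3, x4, zipBin m a.length b.length acc, [], [], [], [], [], []])
      (m * (15 * N + 26) + 1) := by
  induction m using Nat.strong_induction_on generalizing a b c acc with
  | _ m ih =>
    rw [zipBin]
    split_ifs with h0
    · subst h0
      rw [List.length_eq_zero_iff.mp hc, List.length_eq_zero_iff.mp (Nat.le_zero.mp ha),
        List.length_eq_zero_iff.mp (Nat.le_zero.mp hb)]
      exact (exec_loop_done rfl).mono (by omega)
    · have h1 : Exec O (halve 7 10 5) (st [x, [], x2, x3, x4, acc, a, b, c, [], [], []])
        (st [x, [], x2, x3, x4, decide (b.length % 2 = 1) :: acc, a, ones (b.length / 2), c, [], [],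
          []]) (5 * N + 8) := (exec_halve rfl).mono (by simp; omega)
      have h2 : Exec O (halve 6 10 5)
        (st [x, [], x2, x3, x4, decide (b.length % 2 = 1) :: acc, a, ones (b.length / 2), c, [], [],
          []])
        (st [x, [], x2, x3, x4, decide (a.length % 2 = 1) :: decide (b.length % 2 = 1) :: acc,
          ones (a.length / 2), ones (b.length / 2), c, [], [], []]) (5 * N + 8) :=
          (exec_halve rfl).mono (by simp; omega)
      set acc' := decide (a.length % 2 = 1) :: decide (b.length % 2 = 1) :: acc
      have h3 : Exec O (halve 8 10 11)
        (st [x, [], x2, x3, x4, acc', ones (a.length / 2), ones (b.length / 2), c, [], [], []])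
        (st [x, [], x2, x3, x4, acc', ones (a.length / 2), ones (b.length / 2), ones (m / 2), [],
          [], [decide (m % 2 = 1)]]) (5 * N + 8) :=
          (exec_halve (by simp [hc])).mono (by simp; omega)
      have h4 := ih (m / 2) (by omega) (by omega) (ones (a.length / 2)) (ones (b.length / 2))
        (ones (m / 2)) acc' (by simp; omega) (by simp; omega) (by simp)
      simp only [List.length_replicate] at h4
      refine (exec_loop_step (by rintro h; simp [st] at h; simp [h] at hc; omega)
        (h1.seq (h2.seq (h3.seq (exec_pop rfl)))) h4).mono ?_
      have : m / 2 * (15 * N + 26) + (15 * N + 26) ≤ m * (15 * N + 26) := by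
        rw [← Nat.succ_mul]
        gcongr
        omega
      omega

/-- A bound for the number of steps of `assembleStep`, when the numbers are at most `N`. -/
def assembleStepCost (M : Prog) (tM : ℕ → ℕ) (N : ℕ) : ℕ :=
  1 + (1 + (9 * N + 2 + (9 * N + 2 + (9 * N + 2 + (9 * N + 2 + (N * (15 * N + 26) + 1 +
    (callCost M ((2 * N) ^ 2) (tM N) + (5 + (2 * (2 * N) ^ 2 + 1)))))))))

theorem exec_assembleStep {M : Prog} {tM : ℕ → ℕ} {N : ℕ} {S : Set (List Bool)}
    (hM : ∀ z : List Bool, 2 ^ z.length ≤ (2 * N) ^ 2 →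
      OutputsIn ∅ M z [] (tM N) (some (answer S z)))
    {x : List Bool} {i k : ℕ} {u : List Bool} (hN : x.length + (k + 1) ≤ N) :
    Exec ∅ (assembleStep M) (st [x, [], ones (i + 1), ones k, u, [], [], [], [], [], [], []])
      (st [x, [], ones i, ones (k + 1),
        answer S (zipBin (x.length + (k + 1)) x.length (k + 1) []) :: u, [], [], [], [], [], [], []])
      (assembleStepCost M tM N) := by
  set n := x.length with hn
  set m := n + (k + 1) with hm
  have h1 : Exec ∅ (.pop 2) (st [x, [], ones (i + 1), ones k, u, [], [], [], [], [], [], []])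
    (st [x, [], ones i, ones k, u, [], [], [], [], [], [], []]) 1 := exec_pop rfl
  have h2 : Exec ∅ (.push 3 true) (st [x, [], ones i, ones k, u, [], [], [], [], [], [], []])
    (st [x, [], ones i, ones (k + 1), u, [], [], [], [], [], [], []]) 1 := exec_push rfl
  have h3 : Exec ∅ (copy 0 6 10) (st [x, [], ones i, ones (k + 1), u, [], [], [], [], [], [], []])
    (st [x, [], ones i, ones (k + 1), u, [], x, [], [], [], [], []]) (9 * N + 2) :=
      (exec_copy (by simp)).mono (by simp; omega)
  have h4 : Exec ∅ (copy 3 7 10) (st [x, [], ones i, ones (k + 1), u, [], x, [], [], [], [], []])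
    (st [x, [], ones i, ones (k + 1), u, [], x, ones (k + 1), [], [], [], []]) (9 * N + 2) :=
      (exec_copy (by simp)).mono (by simp; omega)
  have h5 : Exec ∅ (copy 0 8 10)
    (st [x, [], ones i, ones (k + 1), u, [], x, ones (k + 1), [], [], [], []])
    (st [x, [], ones i, ones (k + 1), u, [], x, ones (k + 1), x, [], [], []]) (9 * N + 2) :=
      (exec_copy (by simp)).mono (by simp; omega)
  have h6 : Exec ∅ (copy 3 8 10)
    (st [x, [], ones i, ones (k + 1), u, [], x, ones (k + 1), x, [], [], []])
    (st [x, [], ones i, ones (k + 1), u, [], x, ones (k + 1), ones (k + 1) ++ x, [], [], []])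
    (9 * N + 2) := (exec_copy rfl).mono (by simp; omega)
  have h7 := exec_zipLoop (O := ∅) (x := x) (x2 := ones i) (x3 := ones (k + 1)) (x4 := u) m hN x
    (ones (k + 1)) (ones (k + 1) ++ x) [] (by omega) (by simp [hm]) (by simp [hm, hn]; omega)
  rw [List.length_replicate] at h7
  have hz : 2 ^ (zipBin m n (k + 1) []).length ≤ (2 * N) ^ 2 := by
    refine (two_pow_length_zipBin m n (k + 1) (by omega) []).trans ?_
    simp only [List.length_nil, pow_zero, mul_one]
    gcongr
  have hzl : (zipBin m n (k + 1) []).length ≤ (2 * N) ^ 2 := Nat.lt_two_pow_self.le.trans hz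
  rw [← hn] at h7
  set z := zipBin m n (k + 1) []
  -- The empty register `1` is passed as auxiliary input, as `M` is a plain decider.
  have h8 : Exec ∅ (call M 12 5 1 9) (st [x, [], ones i, ones (k + 1), u, z, [], [], [], [], [], []])
    (st [x, [], ones i, ones (k + 1), u, z, [], [], [], [answer S z], [], []])
    (callCost M ((2 * N) ^ 2) (tM N)) :=
      (exec_call (L := [x, [], ones i, ones (k + 1), u, z, [], [], [], [], [], []]) (a := 5) (b := 1)
        (hM z hz) (by simp)).mono (callCost_mono (by simpa using hzl) le_rfl)
  have h9 : Exec ∅ (move 9 4)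
    (st [x, [], ones i, ones (k + 1), u, z, [], [], [], [answer S z], [], []])
    (st [x, [], ones i, ones (k + 1), answer S z :: u, z, [], [], [], [], [], []]) 5 := exec_move rfl
  have h10 : Exec ∅ (clear 5)
    (st [x, [], ones i, ones (k + 1), answer S z :: u, z, [], [], [], [], [], []])
    (st [x, [], ones i, ones (k + 1), answer S z :: u, [], [], [], [], [], [], []])
    (2 * (2 * N) ^ 2 + 1) := (exec_clear rfl).mono (by simpa using hzl)
  exact h1.seq (h2.seq (h3.seq (h4.seq (h5.seq (h6.seq ((h7.mono (by gcongr)).seq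
    (h8.seq (h9.seq h10))))))))

/-- A bound for the number of steps of `assembleProg`. -/
def assembleCost (A M : Prog) (p t τ tM : ℕ → ℕ) (n : ℕ) : ℕ :=
  τ n + (p n * (assembleStepCost M tM (n + p n) + 1) + 1 + (callCost A (n + p n) (t n) +
    (2 * n + 1 + 5)))

/-- The loop holds `searchWord` up to the current position, and the next bit is a membership
question about a code of logarithmic length. The argument `N` of `tM` is `n + p n`, an upper bound
for both coded numbers together. -/
theorem outputsIn_assembleProg {A M : Prog} {p t tM : ℕ → ℕ} (hP : UComputes P p τ)
    (hM : ∀ N, ∀ z : List Bool, 2 ^ z.length ≤ (2 * N) ^ 2 →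
      OutputsIn ∅ M z [] (tM N) (some (answer (searchLang O) z)))
    {x : List Bool} {b : Bool}
    (hA : OutputsIn ∅ A x (searchWord O x.length (p x.length)) (t x.length) (some b)) :
    OutputsIn ∅ (assembleProg A M P) x [] (assembleCost A M p t τ tM x.length) (some b) := by
  set n := x.length with hn
  have h1 : Exec ∅ (ucall P 12 0 2) (st [x, [], [], [], [], [], [], [], [], [], [], []])
    (st [x, [], ones (p n), [], [], [], [], [], [], [], [], []]) (τ n) :=
      exec_ucall hP (by simp [hn])
  have h2 := exec_loop_seq (O := ∅) (P := assembleStep M) (r := 2) (n := p n)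
    (k := assembleStepCost M tM (n + p n))
    (fun i => st [x, [], ones i, ones (p n - i), searchWord O n (p n - i), [], [], [], [], [], [], []])
    (by simp [st])
    (fun i hi => by
      refine ⟨by simp [st], ?_⟩
      have h := exec_assembleStep (hM (n + p n)) (x := x) (i := i) (k := p n - (i + 1))
        (u := searchWord O n (p n - (i + 1))) (by omega)
      rw [show p n - i = p n - (i + 1) + 1 by omega]
      convert h using 6
      rw [searchWord]
      congr 2
      rw [Bool.eq_iff_iff, answer_eq_true, ← hn]
      simp only [searchLang, Set.mem_ofPred_eq]
      rw [unzipBin_zipBin _ _ _ (by omega) (by omega), unzipBin, searchWord]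
      simp)
  rw [Nat.sub_self, Nat.sub_zero] at h2
  set y := searchWord O n (p n) with hy
  have h3 : Exec ∅ (call A 12 0 4 11)
    (st [x, [], [], ones (p n), y, [], [], [], [], [], [], []])
    (st [x, [], [], ones (p n), y, [], [], [], [], [], [], [b]]) (callCost A (n + p n) (t n)) :=
      (exec_call hA (by simp)).mono (by simp [hn, hy])
  have h4 : Exec ∅ (clear 0) (st [x, [], [], ones (p n), y, [], [], [], [], [], [], [b]])
    (st [[], [], [], ones (p n), y, [], [], [], [], [], [], [b]]) (2 * n + 1) := exec_clear rfl
  have h5 : Exec ∅ (move 11 0) (st [[], [], [], ones (p n), y, [], [], [], [], [], [], [b]])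
    (st [[b], [], [], ones (p n), y, [], [], [], [], [], [], []]) 5 := exec_move rfl
  exact (h1.seq (h2.seq (h3.seq (h4.seq h5)))).outputsIn (n := 10) rfl

theorem classYP_subset_of_classE_eq (h : classE = classNENPNP) : classYP ⊆ classP := by
  rintro L ⟨A, p, hp, t, ht, hL⟩
  set S := searchLang (extendableLang A p t)
  have hS : S ∈ classE := by
    rw [h]
    refine ⟨_, ⟨_, unreliableLang_mem_classNP (A := A) ht fun x y => ?_,
      extendableLang_mem_nTimeOracle hp⟩, searchLang_mem_nTimeOracle _⟩
    exact ((hL x.length).2 x y rfl).elim (fun h => ⟨_, h⟩) fun h => ⟨_, h⟩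
  obtain ⟨M, u, ⟨c, d, hu⟩, hM⟩ := hS
  obtain ⟨P, τ, hτ, hP⟩ := uComputable_of_mem_polyBounds hp
  set tM : ℕ → ℕ := fun N => 2 ^ d * ((2 * N) ^ 2) ^ c with htM
  -- The time `2 ^ (c * |z| + d)` of `M` equals `2 ^ d * (2 ^ |z|) ^ c`, which is polynomial in `N`
  -- when `2 ^ |z| ≤ (2 * N) ^ 2`.
  have hM' : ∀ N, ∀ z : List Bool, 2 ^ z.length ≤ (2 * N) ^ 2 →
      OutputsIn ∅ M z [] (tM N) (some (answer S z)) := by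
    intro N z hz
    refine (hM z).mono ?_
    rw [hu, pow_add, pow_mul', mul_comm]
    show _ ≤ 2 ^ d * ((2 * N) ^ 2) ^ c
    gcongr
  have hT := timeClass_poly
  have hpb := Bdd.of_mem hp
  have htb := Bdd.of_mem ht
  have hNb : Bdd polyBounds fun n => n + p n := hT.add hT.id hpb
  have htMb : Bdd polyBounds fun n => tM (n + p n) := by
    have := hT.eval_comp (.C (2 ^ d) * ((.C 2 * .X) ^ 2) ^ c) hNb
    simpa only [htM, Polynomial.eval_mul, Polynomial.eval_pow, Polynomial.eval_C,
      Polynomial.eval_X] using this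
  have hsq : Bdd polyBounds fun n => (2 * (n + p n)) ^ 2 := by
    have := hT.eval_comp ((.C 2 * .X) ^ 2) hNb
    simpa only [Polynomial.eval_mul, Polynomial.eval_pow, Polynomial.eval_C,
      Polynomial.eval_X] using this
  obtain ⟨r, hr, hrb⟩ : Bdd polyBounds (assembleCost A M p t τ tM) := by
    unfold assembleCost assembleStepCost
    repeat' with_reducible
      first | assumption | exact hT.const _ | exact hT.id | apply hT.callCost |
        apply hT.add | apply hT.mul
  refine ⟨assembleProg A M P, r, hr, fun x => (outputsIn_assembleProg hP hM' ?_).mono (hrb _)⟩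
  have hrel : Reliable A t x.length
      (searchWord (extendableLang A p t) x.length (p x.length)) := by
    refine reliable_searchWord ?_
    obtain ⟨y, hy, hyx⟩ := (hL x.length).1
    exact ⟨y, hy, fun x' hx' h' => by simpa using (hyx x' hx').det h'⟩
  -- On any advice the machine answers correctly or says "don't know", and reliability of the word
  -- found excludes the latter.
  exact ((hL x.length).2 x _ rfl).resolve_right (hrel x rfl)

end UntrustedAdvice

theorem mainTheorem12 :
    UntrustedAdvice.classZPP ⊆ UntrustedAdvice.classYP ∧
    UntrustedAdvice.classYE =
      UntrustedAdvice.classNE ∩ UntrustedAdvice.coClass UntrustedAdvice.classNE ∧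
    (UntrustedAdvice.classP = UntrustedAdvice.classYP →
      UntrustedAdvice.classE =
        UntrustedAdvice.classNE ∩ UntrustedAdvice.coClass UntrustedAdvice.classNE) ∧
    (UntrustedAdvice.classE = UntrustedAdvice.classNENPNP →
      UntrustedAdvice.classP = UntrustedAdvice.classYP) :=
  ⟨UntrustedAdvice.classZPP_subset,
    UntrustedAdvice.classYE_subset.antisymm UntrustedAdvice.subset_classYE,
    UntrustedAdvice.classE_eq_of_classP_eq,
    fun h => UntrustedAdvice.dTime_subset_yTime.antisymm
      (UntrustedAdvice.classYP_subset_of_classE_eq h)⟩
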